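/- Let $\psi(u)=\Gamma'(u)/\Gamma(u)$ be the digamma function, let $K_0(z)=\int_0^\infty e^{-z\cosh u}\,du$ $(z>0)$ be the modified Bessel function of the second kind of order $0$, and let $\Xi(t)=\xi(\tfrac12+it)$, where $\xi(s)=\tfrac12 s(s-1)\pi^{-s/2}\Gamma(s/2)\zeta(s)$. Then for every real $x>0$, $$\int_0^\infty\bigl(\psi(t+1)-\log t\bigr)\left(\frac{e^{x/2}}{t}-4e^{-x/2}\sum_{n\ge1}K_0\!\left(2\pi n t e^{-x}\right)\right)dt \;=\; 4\int_0^\infty\frac{\Xi(t)^2}{(t^2+\frac14)^2}\,\frac{\cos(xt)}{\cosh(\pi t)}\,dt,$$ where the series converges absolutely for every $t>0$ and both integrals converge absolutely. -/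

import Mathlib

noncomputable section

/-- The modified Bessel function of the second kind `K_ν(z)` for real `ν` and `z > 0`, by its
standard integral `K_ν(z) = ∫₀^∞ exp(-z cosh u) cosh(ν u) du`. -/
def besselK (ν z : ℝ) : ℝ :=
  ∫ u in Set.Ioi (0 : ℝ), Real.exp (-z * Real.cosh u) * Real.cosh (ν * u)

/-- Riemann's xi function `ξ(s) = ½ s (s - 1) π^(-s/2) Γ(s/2) ζ(s)`. -/
def riemannXiLower (s : ℂ) : ℂ :=
  1 / 2 * s * (s - 1) * (Real.pi : ℂ) ^ (-s / 2) * Complex.Gamma (s / 2) * riemannZeta s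

/-- `Ξ(t) = ξ(½ + i t)` for real `t`. -/
def riemannXiUpper (t : ℝ) : ℂ :=
  riemannXiLower (1 / 2 + Complex.I * (t : ℂ))

/-- The function
`(ψ(t + 1) - log t) (e^{x/2} / t - 4 e^{-x/2} ∑_{n ≥ 1} K₀(2 π n t e^{-x}))` of `t > 0`, where `ψ = Γ'/Γ`. -/
def digammaBesselIntegrand (x t : ℝ) : ℂ :=
  (Complex.digamma ((t : ℂ) + 1) - (Real.log t : ℂ)) *
    ((Real.exp (x / 2) / t
      - 4 * Real.exp (-x / 2) *
        ∑' n : ℕ, besselK 0 (2 * Real.pi * ((n : ℝ) + 1) * t * Real.exp (-x)) : ℝ) : ℂ)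

/-- The function `Ξ(t)² / (t² + ¼)² · cos(x t) / cosh(π t)` of `t`. -/
def xiSquaredIntegrand (x t : ℝ) : ℂ :=
  riemannXiUpper t ^ 2 / ((t : ℂ) ^ 2 + 1 / 4) ^ 2 *
    ((Real.cos (x * t) / Real.cosh (Real.pi * t) : ℝ) : ℂ)

end

open Real Set Filter Topology MeasureTheory

/-! Both integrals reduce to one pairing of a theta function with itself. Put `g = thetaGapLog`.
Poisson summation makes `g` even, comparison of a Riemann sum with its integral makes it
nonnegative, and together these give `g r ≤ exp (-|r| / 2)`. The pairing is `P x = ∬ g r * g s /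
cosh ((x + r + s) / 2)`.

On the xi side, the polynomial factor of `Ξ` cancels against `t² + 1/4`, leaving `Λ(1/2 + it)² / 4`,
and `Λ(1/2 + it)` is minus the Fourier transform of `g` (`completedRiemannZeta_critical_line`).
Since sech is its own Fourier transform up to scaling (`integral_cexp_div_cosh`), Fubini turns the
half-line integral into `P x / 8`.

On the digamma side, the Bessel factor is a Gaussian transform of `thetaGap`
(`lintegral_thetaGap_gaussian`). The factor `ψ(t + 1) - log t` is the Laplace transform of Binet's
kernel (`digamma_add_one_sub_log`), itself a Gaussian transform of `thetaGap` by the partial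
fractions of the cotangent (`lintegral_thetaGap_mul_gaussian`). Everything is nonnegative, so
Tonelli applies freely; an elementary quadrant Gaussian leaves the Hilbert-type kernel `1 / (v + exp
(-x) * w)`, which in logarithmic coordinates gives `P x / 2`. -/

/-! ### The theta deficit: functional equation, positivity and decay. -/

/-- The deficit `1 / w - 2 ∑_{n ≥ 1} exp (-π n² w²)` between a Gaussian integral and its
Riemann sum, written through the Jacobi theta kernel. -/
noncomputable def thetaGap (w : ℝ) : ℝ := 1 / w + 1 - HurwitzZeta.evenKernel 0 (w ^ 2)

theorem hasSum_gaussian_thetaGap {w : ℝ} (hw : 0 < w) :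
    HasSum (fun n : ℕ ↦ 2 * exp (-π * ((n : ℝ) + 1) ^ 2 * w ^ 2)) (1 / w - thetaGap w) := by
  have h := HurwitzZeta.hasSum_nat_cosKernel₀ 0 (pow_pos hw 2)
  rw [thetaGap, HurwitzZeta.evenKernel_eq_cosKernel_of_zero]
  simp only [mul_zero, zero_mul, Real.cos_zero, mul_one, QuotientAddGroup.mk_zero] at h
  convert h using 1
  ring

theorem thetaGap_le_inv {w : ℝ} (hw : 0 < w) : thetaGap w ≤ 1 / w := by
  have := (hasSum_gaussian_thetaGap hw).nonneg (fun n ↦ by positivity)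
  linarith

/-- Jacobi's functional equation; the correction `1 / w + 1` obeys the same rule under `w ↦ 1 / w`.
-/
theorem thetaGap_inv {w : ℝ} (hw : 0 < w) : thetaGap (1 / w) = w * thetaGap w := by
  have h := HurwitzZeta.evenKernel_functional_equation 0 (w ^ 2)
  rw [← HurwitzZeta.evenKernel_eq_cosKernel_of_zero, ← Real.sqrt_eq_rpow, Real.sqrt_sq hw.le] at h
  simp only [thetaGap, div_pow, one_pow, h]
  field_simp
  ring

/-- A right-endpoint Riemann sum of a decreasing function is at most its integral. -/
theorem thetaGap_nonneg {w : ℝ} (hw : 0 < w) : 0 ≤ thetaGap w := by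
  have hb : 0 < π * w ^ 2 := by positivity
  have hint : Integrable (fun x : ℝ ↦ exp (-(π * w ^ 2) * x ^ 2)) := integrable_exp_neg_mul_sq hb
  have hanti : AntitoneOn (fun x : ℝ ↦ exp (-(π * w ^ 2) * x ^ 2)) (Ici 0) := by
    intro a ha b hb' hab
    simp only [mem_Ici] at ha hb'
    refine exp_le_exp.2 ?_
    have := pow_le_pow_left₀ ha hab 2
    nlinarith
  have h1 := hanti.tsum_add_one_le_integral hint.integrableOn (fun _ _ ↦ (exp_pos _).le)
  rw [integral_gaussian_Ioi, Real.sqrt_div' _ hb.le, Real.sqrt_mul' _ (sq_nonneg w),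
    Real.sqrt_sq hw.le] at h1
  have h2 := ((hasSum_gaussian_thetaGap hw).mul_left (1 / 2)).tsum_eq
  have h3 : (∑' n : ℕ, exp (-(π * w ^ 2) * ((n + 1 : ℕ) : ℝ) ^ 2)) =
      1 / 2 * (1 / w - thetaGap w) := by
    rw [← h2]
    refine tsum_congr fun n ↦ ?_
    push_cast
    ring_nf
  rw [h3] at h1
  have h4 : √π / (√π * w) = 1 / w := by
    have := Real.sqrt_pos.2 Real.pi_pos
    field_simp
  rw [h4] at h1
  linarith

theorem thetaGap_le_one {w : ℝ} (hw : 0 < w) : thetaGap w ≤ 1 := by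
  have h := thetaGap_le_inv (one_div_pos.2 hw)
  rw [thetaGap_inv hw, one_div_one_div] at h
  exact le_of_mul_le_mul_left (by simpa using h) hw

theorem measurable_thetaGap : Measurable thetaGap := by
  have h : Measurable (HurwitzZeta.evenKernel 0) := by
    have h1 : HurwitzZeta.evenKernel 0 = (Ioi (0 : ℝ)).indicator (HurwitzZeta.evenKernel 0) := by
      ext x
      by_cases hx : x ∈ Ioi (0 : ℝ)
      · simp [hx]
      · rw [indicator_of_notMem hx, HurwitzZeta.evenKernel_undef _ (not_lt.1 hx)]
    rw [h1]
    have h2 := (HurwitzZeta.continuousOn_evenKernel 0).measurable_piecewise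
      (continuousOn_const (c := (0 : ℝ)) (s := (Ioi (0 : ℝ))ᶜ)) measurableSet_Ioi
    rw [← piecewise_eq_indicator]
    exact h2
  unfold thetaGap
  fun_prop

/-- The logarithmic form `exp (r / 2) * thetaGap (exp r)`, an even function of `r`. -/
noncomputable def thetaGapLog (r : ℝ) : ℝ := exp (r / 2) * thetaGap (exp r)

theorem thetaGapLog_nonneg (r : ℝ) : 0 ≤ thetaGapLog r :=
  mul_nonneg (exp_pos _).le (thetaGap_nonneg (exp_pos _))

theorem thetaGapLog_neg (r : ℝ) : thetaGapLog (-r) = thetaGapLog r := by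
  have h := thetaGap_inv (exp_pos r)
  rw [one_div, ← exp_neg] at h
  rw [thetaGapLog, thetaGapLog, h, ← mul_assoc, ← exp_add]
  ring_nf

theorem measurable_thetaGapLog : Measurable thetaGapLog := by
  unfold thetaGapLog
  have := measurable_thetaGap
  fun_prop

/-- Evenness reduces to `r ≤ 0`, where `thetaGap ≤ 1` already suffices. -/
theorem thetaGapLog_le (r : ℝ) : thetaGapLog r ≤ exp (-(1 / 2) * |r|) := by
  have key : ∀ s : ℝ, s ≤ 0 → thetaGapLog s ≤ exp (-(1 / 2) * |s|) := by
    intro s hs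
    rw [abs_of_nonpos hs, thetaGapLog]
    have h1 : exp (s / 2) * thetaGap (exp s) ≤ exp (s / 2) * 1 :=
      mul_le_mul_of_nonneg_left (thetaGap_le_one (exp_pos s)) (exp_pos _).le
    refine h1.trans (le_of_eq ?_)
    ring_nf
  rcases le_total r 0 with h | h
  · exact key r h
  · have := key (-r) (by linarith)
    rwa [thetaGapLog_neg, abs_neg] at this

theorem integrable_exp_neg_mul_abs {c : ℝ} (hc : 0 < c) :
    Integrable (fun r : ℝ ↦ exp (-c * |r|)) := by
  have h1 := integrableOn_exp_mul_Iic hc 0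
  have h2 := integrableOn_exp_mul_Ioi (neg_lt_zero.2 hc) 0
  rw [← integrableOn_univ, ← Iic_union_Ioi (a := (0 : ℝ))]
  refine IntegrableOn.union (h1.congr_fun (fun x hx ↦ ?_) measurableSet_Iic)
    (h2.congr_fun (fun x hx ↦ ?_) measurableSet_Ioi)
  · simp only [abs_of_nonpos (mem_Iic.1 hx)]; ring_nf
  · simp only [abs_of_pos (mem_Ioi.1 hx)]

theorem integrable_thetaGapLog : Integrable thetaGapLog := by
  have h := integrable_exp_neg_mul_abs (c := 1 / 2) (by norm_num)
  refine h.mono' measurable_thetaGapLog.aestronglyMeasurable (ae_of_all _ fun r ↦ ?_)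
  rw [Real.norm_of_nonneg (thetaGapLog_nonneg r)]
  exact thetaGapLog_le r

/-! ### Mellin transforms and the zeta function on the critical line. -/

/-- The substitution `v = exp r`. -/
theorem lintegral_Ioi_eq_lintegral_exp (f : ℝ → ENNReal) :
    ∫⁻ v in Ioi (0 : ℝ), f v = ∫⁻ r, ENNReal.ofReal (exp r) * f (exp r) := by
  have h := lintegral_image_eq_lintegral_abs_deriv_mul (s := univ) MeasurableSet.univ
    (fun x _ ↦ (Real.hasDerivAt_exp x).hasDerivWithinAt) (Real.exp_injective.injOn) f
  rw [image_univ, Real.range_exp, Measure.restrict_univ] at h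
  simpa [abs_of_pos (exp_pos _)] using h

theorem integral_Ioi_eq_integral_exp {E : Type*} [NormedAddCommGroup E] [NormedSpace ℝ E]
    (f : ℝ → E) : ∫ v in Ioi (0 : ℝ), f v = ∫ r, exp r • f (exp r) := by
  have h := integral_image_eq_integral_abs_deriv_smul (s := univ) MeasurableSet.univ
    (fun x _ ↦ (Real.hasDerivAt_exp x).hasDerivWithinAt) (Real.exp_injective.injOn) f
  rw [image_univ, Real.range_exp, Measure.restrict_univ] at h
  simpa [abs_of_pos (exp_pos _)] using h

/-- The Mellin transform of a weak FE-pair with both constant terms removed, in the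
critical strip. -/
theorem WeakFEPair.mellin_sub_sub_eq_Λ (P : WeakFEPair ℂ) {s : ℂ} (h0 : 0 < s.re)
    (h1 : s.re < P.k) :
    mellin (fun x : ℝ ↦ P.f x - P.f₀ - P.ε * (x : ℂ) ^ (-P.k : ℂ) * P.g₀) s = P.Λ s := by
  have hm : MellinConvergent P.f_modif s := (P.isStrongFEPair_toStrongFEPair.hasMellin s).1
  -- `P.f_modif` removes one asymptotic term on each side of 1. The term still missing is `P.f₀` on
  -- `(0, 1]` and the power on `(1, ∞)`; their Mellin transforms `1 / s` and `1 / (k - s)` converge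
  -- exactly in the strip and account for the poles separating `Λ₀` from `Λ`.
  have hA := hasMellin_one_Ioc h0
  have hA' := (hA.1.const_smul P.f₀)
  have hcongr : EqOn (fun t : ℝ ↦ (t : ℂ) ^ (s - 1) *
      (Ioi (1 : ℝ)).indicator (fun x : ℝ ↦ (x : ℂ) ^ (-P.k : ℂ)) t)
      ((Ioi (1 : ℝ)).indicator (fun t : ℝ ↦ (t : ℂ) ^ (s - 1 - P.k))) (Ioi 0) := by
    intro t ht
    simp only [indicator]
    split_ifs
    · rw [← Complex.cpow_add _ _ (Complex.ofReal_ne_zero.2 (ne_of_gt ht)), ← sub_eq_add_neg]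
    · simp
  have hre : (s - 1 - P.k).re < -1 := by simp; linarith
  have hBint : IntegrableOn ((Ioi (1 : ℝ)).indicator (fun t : ℝ ↦ (t : ℂ) ^ (s - 1 - P.k)))
      (Ioi 0) := by
    rw [IntegrableOn, integrable_indicator_iff measurableSet_Ioi, IntegrableOn,
      Measure.restrict_restrict measurableSet_Ioi,
      inter_eq_left.2 (Ioi_subset_Ioi zero_le_one)]
    exact integrableOn_Ioi_cpow_of_lt hre one_pos
  have hB : HasMellin (fun t ↦ (Ioi (1 : ℝ)).indicator (fun x : ℝ ↦ (x : ℂ) ^ (-P.k : ℂ)) t) s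
      (1 / (P.k - s)) := by
    refine ⟨?_, ?_⟩
    · exact hBint.congr_fun (fun t ht ↦ by simpa using (hcongr ht).symm) measurableSet_Ioi
    · simp only [mellin, smul_eq_mul]
      rw [setIntegral_congr_fun measurableSet_Ioi hcongr, setIntegral_indicator measurableSet_Ioi,
        inter_eq_right.2 (Ioi_subset_Ioi zero_le_one), integral_Ioi_cpow_of_lt hre one_pos]
      simp only [Complex.ofReal_one, Complex.one_cpow]
      rw [neg_div, ← div_neg]
      congr 1
      ring
  have hT := (hasMellin_sub (hasMellin_sub hm hA').1 (hB.1.const_smul (P.ε * P.g₀)))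
  have hA2 : mellin (fun t ↦ P.f₀ • (Ioc (0 : ℝ) 1).indicator (fun _ ↦ (1 : ℂ)) t) s
      = P.f₀ * (1 / s) := by
    rw [mellin_const_smul, hA.2, smul_eq_mul]
  have hB2 : mellin (fun t ↦ (P.ε * P.g₀) •
      (Ioi (1 : ℝ)).indicator (fun x : ℝ ↦ (x : ℂ) ^ (-P.k : ℂ)) t) s
      = P.ε * P.g₀ * (1 / (P.k - s)) := by
    rw [mellin_const_smul, hB.2, smul_eq_mul]
  have hval := hT.2
  rw [(hasMellin_sub hm hA').2, hA2, hB2] at hval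
  have : P.Λ s = mellin P.f_modif s - P.f₀ * (1 / s) - P.ε * P.g₀ * (1 / (P.k - s)) := by
    rw [WeakFEPair.Λ, WeakFEPair.Λ₀]
    simp only [smul_eq_mul]
    ring
  rw [this, ← hval]
  refine setIntegral_congr_ae measurableSet_Ioi ?_
  -- At the point 1 itself `P.f_modif` is zero, so the pointwise identity may fail there.
  have hne : ∀ᵐ t : ℝ, t ≠ 1 := by simp [ae_iff]
  filter_upwards [hne] with t ht1 ht0
  congr 1
  rw [WeakFEPair.f_modif, Pi.add_apply]
  have hcp : (((t ^ (-P.k) : ℝ)) : ℂ) = (t : ℂ) ^ (-P.k : ℂ) := by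
    rw [Complex.ofReal_cpow (le_of_lt ht0)]; simp
  rcases lt_or_gt_of_ne ht1 with h | h
  · rw [indicator_of_notMem (notMem_Ioi.2 h.le), indicator_of_mem (mem_Ioo.2 ⟨ht0, h⟩),
      indicator_of_mem (mem_Ioc.2 ⟨ht0, h.le⟩), indicator_of_notMem (notMem_Ioi.2 h.le), hcp]
    simp only [smul_eq_mul]
    ring
  · rw [indicator_of_mem (mem_Ioi.2 h), indicator_of_notMem (notMem_Ioo_of_ge h.le),
      indicator_of_notMem (notMem_Ioc_of_gt h), indicator_of_mem (mem_Ioi.2 h)]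
    simp only [smul_eq_mul]
    ring

/-- On the critical line, the completed zeta function is minus the Fourier transform of
`thetaGapLog`. -/
theorem completedRiemannZeta_critical_line (t : ℝ) :
    completedRiemannZeta (1 / 2 + Complex.I * t) =
      -∫ r : ℝ, Complex.exp (Complex.I * t * r) * thetaGapLog r := by
  have hs : ((1 / 2 + Complex.I * t) / 2 : ℂ).re = 1 / 4 := by
    have : ((1 / 2 + Complex.I * t) / 2 : ℂ) = ((1 / 4 : ℝ) : ℂ) + (t / 2 : ℝ) * Complex.I := by
      push_cast; ring
    rw [this, Complex.add_re, Complex.ofReal_re, Complex.re_ofReal_mul, Complex.I_re]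
    simp
  have h := WeakFEPair.mellin_sub_sub_eq_Λ (HurwitzZeta.hurwitzEvenFEPair 0)
    (s := (1 / 2 + Complex.I * t) / 2) (by rw [hs]; norm_num)
    (by rw [hs]; simp only [HurwitzZeta.hurwitzEvenFEPair]; norm_num)
  have hdef : completedRiemannZeta (1 / 2 + Complex.I * t) =
    (HurwitzZeta.hurwitzEvenFEPair 0).Λ ((1 / 2 + Complex.I * t) / 2) / 2 := rfl
  rw [hdef, ← h, mellin, integral_Ioi_eq_integral_exp]
  simp only [HurwitzZeta.hurwitzEvenFEPair, if_true]
  -- The kernel is evaluated at `w ^ 2` with `w = exp r`, hence `ρ = 2 * r`; the Jacobian absorbs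
  -- the division by 2 in the definition of the completed zeta function.
  have hsc := Measure.integral_comp_mul_left (fun ρ : ℝ ↦ rexp ρ •
    ((rexp ρ : ℂ) ^ ((1 / 2 + Complex.I * t) / 2 - 1 : ℂ) •
    ((Complex.ofReal ∘ HurwitzZeta.evenKernel 0) (rexp ρ) - 1
      - 1 * (rexp ρ : ℂ) ^ (-((1 / 2 : ℝ) : ℂ)) * 1))) 2
  rw [abs_of_pos (by norm_num : (0 : ℝ) < 2⁻¹)] at hsc
  have h2 : ∀ z w : ℂ, w = (2⁻¹ : ℝ) • z → z / 2 = w := by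
    rintro z w rfl
    rw [Complex.real_smul]; push_cast; ring
  refine h2 _ _ (Eq.trans ?_ hsc)
  rw [← integral_neg]
  refine integral_congr_ae (ae_of_all _ fun r ↦ ?_)
  have hc : ∀ (a : ℂ), (rexp (2 * r) : ℂ) ^ a = Complex.exp (2 * r * a) := by
    intro a
    rw [Complex.cpow_def_of_ne_zero (by exact_mod_cast (exp_pos _).ne'), ← Complex.ofReal_log
      (exp_pos _).le, Real.log_exp]
    push_cast
    ring_nf
  have hth : HurwitzZeta.evenKernel 0 (rexp (2 * r)) =
      1 / rexp r + 1 - thetaGap (rexp r) := by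
    rw [thetaGap, ← exp_nat_mul]; push_cast; ring
  simp only [Function.comp_apply, hc, hth, thetaGapLog, smul_eq_mul, Complex.real_smul]
  have e1 : Complex.exp (2 * r * -((1 / 2 : ℝ) : ℂ)) = ((1 / rexp r : ℝ) : ℂ) := by
    rw [one_div (rexp r), ← exp_neg, Complex.ofReal_exp]
    congr 1; push_cast; ring
  have e2 : ((rexp (2 * r) : ℝ) : ℂ) * Complex.exp (2 * r * ((1 / 2 + Complex.I * t) / 2 - 1)) =
      Complex.exp (Complex.I * t * r) * (rexp (r / 2) : ℝ) := by
    rw [Complex.ofReal_exp, Complex.ofReal_exp, ← Complex.exp_add, ← Complex.exp_add]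
    congr 1; push_cast; ring
  rw [e1, ← mul_assoc, e2]
  push_cast
  ring

/-- On the critical line `s * (s - 1) = -(t ^ 2 + 1 / 4)`, which cancels the denominator after
squaring. -/
theorem riemannXiUpper_sq_div (t : ℝ) :
    riemannXiUpper t ^ 2 / ((t : ℂ) ^ 2 + 1 / 4) ^ 2 =
      completedRiemannZeta (1 / 2 + Complex.I * t) ^ 2 / 4 := by
  set s : ℂ := 1 / 2 + Complex.I * t with hs
  have hre : s.re = 1 / 2 := by simp [hs]
  have hs0 : s ≠ 0 := by
    intro h; rw [h] at hre; norm_num at hre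
  have hG : Complex.Gammaℝ s ≠ 0 := Complex.Gammaℝ_ne_zero_of_re_pos (by rw [hre]; norm_num)
  have hx : riemannXiUpper t = 1 / 2 * s * (s - 1) * completedRiemannZeta s := by
    rw [riemannXiUpper, ← hs, riemannXiLower, riemannZeta_def_of_ne_zero hs0]
    have : (π : ℂ) ^ (-s / 2) * Complex.Gamma (s / 2) = Complex.Gammaℝ s := rfl
    rw [mul_assoc _ ((π : ℂ) ^ (-s / 2)), this]
    field_simp
  have hss : s * (s - 1) = -((t : ℂ) ^ 2 + 1 / 4) := by
    rw [hs]; ring_nf; rw [Complex.I_sq]; ring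
  have hne : (t : ℂ) ^ 2 + 1 / 4 ≠ 0 := by
    have : (t : ℂ) ^ 2 + 1 / 4 = ((t ^ 2 + 1 / 4 : ℝ) : ℂ) := by push_cast; ring
    rw [this]; exact_mod_cast (by positivity : t ^ 2 + 1 / 4 ≠ 0)
  rw [hx, mul_assoc (1 / 2 : ℂ), hss]
  rw [div_eq_iff (pow_ne_zero 2 hne)]
  ring

/-! ### The Bessel series as a Gaussian transform. -/

theorem integrableOn_exp_neg_mul_cosh {z : ℝ} (hz : 0 < z) :
    IntegrableOn (fun u ↦ exp (-z * cosh u)) (Ioi 0) := by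
  have h := integrableOn_exp_mul_Ioi (a := -z / 2) (by linarith) 0
  refine Integrable.mono' h (by fun_prop) ?_
  filter_upwards [ae_restrict_mem measurableSet_Ioi] with u hu
  rw [Real.norm_of_nonneg (exp_pos _).le]
  refine exp_le_exp.2 ?_
  have h1 : u ≤ 2 * cosh u := by
    rw [cosh_eq]
    have := add_one_le_exp u
    have := exp_pos (-u)
    linarith
  nlinarith

theorem ofReal_besselK_zero {z : ℝ} (hz : 0 < z) :
    ENNReal.ofReal (besselK 0 z) = ∫⁻ u in Ioi (0 : ℝ), ENNReal.ofReal (exp (-z * cosh u)) := by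
  rw [besselK]
  simp only [zero_mul, Real.cosh_zero, mul_one]
  exact ofReal_integral_eq_lintegral_ofReal (integrableOn_exp_neg_mul_cosh hz)
    (ae_of_all _ fun u ↦ (exp_pos _).le)

theorem besselK_zero_nonneg (z : ℝ) : 0 ≤ besselK 0 z := by
  refine setIntegral_nonneg measurableSet_Ioi fun u _ ↦ ?_
  positivity

theorem lintegral_even (f : ℝ → ENNReal) (hf : ∀ x, f (-x) = f x) :
    ∫⁻ x, f x = 2 * ∫⁻ x in Ioi (0 : ℝ), f x := by
  have h := lintegral_add_compl (μ := volume) f (measurableSet_Ioi (a := (0 : ℝ)))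
  rw [← h, compl_Ioi, two_mul]
  congr 1
  have h2 : ∫⁻ x in Iic (0 : ℝ), f x = ∫⁻ x in Iio (0 : ℝ), f x := by
    rw [Measure.restrict_congr_set Iio_ae_eq_Iic]
  rw [h2]
  have h3 := lintegral_image_eq_lintegral_abs_deriv_mul (s := Ioi (0 : ℝ)) measurableSet_Ioi
    (fun x _ ↦ (hasDerivAt_neg x).hasDerivWithinAt) neg_injective.injOn f
  simp only [image_neg_eq_neg, neg_Ioi, neg_zero, abs_neg, abs_one, ENNReal.ofReal_one, one_mul,
    hf] at h3
  exact h3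

/-- Gaussian integral representation of `K₀`. -/
theorem ofReal_besselK_eq_lintegral {m u : ℝ} (hm : 0 < m) (hu : 0 < u) :
    ENNReal.ofReal (besselK 0 (2 * π * m * u)) =
      ∫⁻ v in Ioi (0 : ℝ), ENNReal.ofReal (exp (-π * m ^ 2 * v ^ 2 - π * u ^ 2 / v ^ 2) / v) := by
  rw [ofReal_besselK_zero (by positivity), lintegral_Ioi_eq_lintegral_exp
    (fun v ↦ ENNReal.ofReal (exp (-π * m ^ 2 * v ^ 2 - π * u ^ 2 / v ^ 2) / v))]
  -- With `v ^ 2 = exp r * u / m` the two terms of the exponent balance to `m * u * exp r` and `m *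
  -- u * exp (-r)`, producing `cosh r`. The Jacobian `1 / 2` is offset by folding the even integrand
  -- onto the half line.
  have hsub := lintegral_image_eq_lintegral_abs_deriv_mul (s := univ) MeasurableSet.univ
    (f := fun r : ℝ ↦ r / 2 + log (u / m) / 2) (f' := fun _ ↦ 1 / 2)
    (fun x _ ↦ (((hasDerivAt_id x).div_const 2).add_const _).hasDerivWithinAt)
    (by intro a _ b _ hab; simpa using hab)
    (fun r ↦ ENNReal.ofReal (rexp r) *
      ENNReal.ofReal (rexp (-π * m ^ 2 * rexp r ^ 2 - π * u ^ 2 / rexp r ^ 2) / rexp r))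
  have himg : (fun r : ℝ ↦ r / 2 + log (u / m) / 2) '' univ = univ := by
    rw [image_univ]
    refine Function.Surjective.range_eq fun y ↦ ⟨2 * y - log (u / m), by ring⟩
  rw [himg, Measure.restrict_univ] at hsub
  rw [hsub]
  have hcongr : ∀ r : ℝ, ENNReal.ofReal |(1 / 2 : ℝ)| *
      (ENNReal.ofReal (rexp (r / 2 + log (u / m) / 2)) *
      ENNReal.ofReal (rexp (-π * m ^ 2 * rexp (r / 2 + log (u / m) / 2) ^ 2 -
        π * u ^ 2 / rexp (r / 2 + log (u / m) / 2) ^ 2) / rexp (r / 2 + log (u / m) / 2)))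
      = ENNReal.ofReal (1 / 2) * ENNReal.ofReal (exp (-(2 * π * m * u) * cosh r)) := by
    intro r
    rw [abs_of_pos (by norm_num), ← ENNReal.ofReal_mul (exp_pos _).le,
      mul_div_cancel₀ _ (exp_pos _).ne']
    congr 3
    have h1 : rexp (r / 2 + log (u / m) / 2) ^ 2 = exp r * (u / m) := by
      rw [← exp_nat_mul]
      push_cast
      rw [show 2 * (r / 2 + log (u / m) / 2) = r + log (u / m) by ring, exp_add,
        exp_log (by positivity)]
    rw [h1, cosh_eq, exp_neg]
    have := exp_pos r
    field_simp
    ring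
  rw [lintegral_congr hcongr, lintegral_const_mul _ (by fun_prop), lintegral_even _ (by simp),
    ← mul_assoc]
  have : ENNReal.ofReal (1 / 2) * 2 = 1 := by
    rw [← ENNReal.ofReal_ofNat, ← ENNReal.ofReal_mul (by norm_num)]; norm_num
  rw [this, one_mul]

/-- The contribution of the `1 / v` part of `thetaGap`; inverting `v` gives a half-line Gaussian. -/
theorem lintegral_gaussian_inv_sq {u : ℝ} (hu : 0 < u) :
    ∫⁻ v in Ioi (0 : ℝ), ENNReal.ofReal (2 * (1 / v) * exp (-π * u ^ 2 / v ^ 2) / v) =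
      ENNReal.ofReal (1 / u) := by
  have h1 : ∫⁻ p in Ioi (0 : ℝ), ENNReal.ofReal (2 * exp (-(π * u ^ 2) * p ^ 2)) =
      ENNReal.ofReal (1 / u) := by
    rw [← ofReal_integral_eq_lintegral_ofReal
      ((integrable_exp_neg_mul_sq (by positivity)).integrableOn.const_mul 2)
      (ae_of_all _ fun p ↦ by positivity), integral_const_mul, integral_gaussian_Ioi]
    congr 1
    rw [Real.sqrt_div' _ (by positivity), Real.sqrt_mul' _ (sq_nonneg u), Real.sqrt_sq hu.le]
    have := Real.sqrt_pos.2 Real.pi_pos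
    field_simp
  rw [← h1, lintegral_Ioi_eq_lintegral_exp, lintegral_Ioi_eq_lintegral_exp,
    ← lintegral_neg_eq_self]
  refine lintegral_congr fun r ↦ ?_
  rw [← ENNReal.ofReal_mul (exp_pos _).le, ← ENNReal.ofReal_mul (exp_pos _).le, exp_neg]
  have := exp_pos r
  congr 1
  field_simp

/-- `∑_{n ≥ 1} K₀(2πnu)` as a Gaussian transform of the theta series. -/
theorem tsum_ofReal_besselK {u : ℝ} (hu : 0 < u) :
    ∑' n : ℕ, ENNReal.ofReal (besselK 0 (2 * π * ((n : ℝ) + 1) * u)) =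
      ∫⁻ v in Ioi (0 : ℝ), ENNReal.ofReal
        ((1 / v - thetaGap v) / 2 * exp (-π * u ^ 2 / v ^ 2) / v) := by
  simp_rw [fun n : ℕ ↦ ofReal_besselK_eq_lintegral (m := (n : ℝ) + 1) (by positivity) hu]
  rw [← lintegral_tsum (fun n ↦ by fun_prop)]
  refine setLIntegral_congr_fun measurableSet_Ioi fun v hv ↦ ?_
  have hv : 0 < v := hv
  have hs := ((hasSum_gaussian_thetaGap hv).mul_right (1 / 2)).mul_right
    (exp (-π * u ^ 2 / v ^ 2) / v)
  have hs2 : HasSum (fun n : ℕ ↦ exp (-π * ((n : ℝ) + 1) ^ 2 * v ^ 2 - π * u ^ 2 / v ^ 2) / v)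
      ((1 / v - thetaGap v) / 2 * exp (-π * u ^ 2 / v ^ 2) / v) := by
    rw [show (1 / v - thetaGap v) / 2 * exp (-π * u ^ 2 / v ^ 2) / v =
      (1 / v - thetaGap v) * (1 / 2) * (exp (-π * u ^ 2 / v ^ 2) / v) by ring]
    refine hs.congr_fun fun n ↦ ?_
    rw [show -π * ((n : ℝ) + 1) ^ 2 * v ^ 2 - π * u ^ 2 / v ^ 2 =
      -π * ((n : ℝ) + 1) ^ 2 * v ^ 2 + -π * u ^ 2 / v ^ 2 by ring, exp_add]
    ring
  rw [← hs2.tsum_eq, ENNReal.ofReal_tsum_of_nonneg (fun n ↦ by positivity) hs2.summable]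

/-- Discards `thetaGap ≥ 0` and wastes a constant factor, as only finiteness is needed for
summability. -/
theorem tsum_ofReal_besselK_le {u : ℝ} (hu : 0 < u) :
    ∑' n : ℕ, ENNReal.ofReal (besselK 0 (2 * π * ((n : ℝ) + 1) * u)) ≤ ENNReal.ofReal (1 / u) := by
  rw [tsum_ofReal_besselK hu, ← lintegral_gaussian_inv_sq hu]
  refine setLIntegral_mono' measurableSet_Ioi fun v hv ↦ ENNReal.ofReal_le_ofReal ?_
  have hv : 0 < v := hv
  gcongr
  have := thetaGap_nonneg hv
  have : 0 < 1 / v := by positivity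
  linarith

theorem summable_besselK {u : ℝ} (hu : 0 < u) :
    Summable fun n : ℕ ↦ besselK 0 (2 * π * ((n : ℝ) + 1) * u) := by
  have h := ((tsum_ofReal_besselK_le hu).trans_lt ENNReal.ofReal_lt_top).ne
  have h2 := ENNReal.summable_toReal h
  refine h2.congr fun n ↦ ?_
  exact ENNReal.toReal_ofReal (besselK_zero_nonneg _)

/-- The integrands add up to the pure `1 / v` Gaussian. The additive form avoids truncated
subtraction in `ENNReal`. -/
theorem lintegral_thetaGap_gaussian_add {u : ℝ} (hu : 0 < u) :
    (∫⁻ v in Ioi (0 : ℝ), ENNReal.ofReal (2 * thetaGap v * exp (-π * u ^ 2 / v ^ 2) / v)) +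
      ENNReal.ofReal (4 * ∑' n : ℕ, besselK 0 (2 * π * ((n : ℝ) + 1) * u)) =
    ENNReal.ofReal (1 / u) := by
  have hsum := tsum_ofReal_besselK hu
  rw [← ENNReal.ofReal_tsum_of_nonneg (fun n ↦ besselK_zero_nonneg _) (summable_besselK hu)] at hsum
  have hm := measurable_thetaGap
  rw [ENNReal.ofReal_mul (by norm_num), hsum, ← lintegral_const_mul _ (by fun_prop),
    ← lintegral_add_left (by fun_prop), ← lintegral_gaussian_inv_sq hu]
  refine setLIntegral_congr_fun measurableSet_Ioi fun v hv ↦ ?_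
  have hv : 0 < v := hv
  have h0 := thetaGap_nonneg hv
  have h1 := sub_nonneg.2 (thetaGap_le_inv hv)
  rw [← ENNReal.ofReal_mul (by norm_num), ← ENNReal.ofReal_add (by positivity) (by positivity)]
  congr 1
  ring

/-- The Gaussian transform of `thetaGap` is `1 / u - 4 ∑_{n ≥ 1} K₀(2πnu)`. -/
theorem lintegral_thetaGap_gaussian {u : ℝ} (hu : 0 < u) :
    ∫⁻ v in Ioi (0 : ℝ), ENNReal.ofReal (2 * thetaGap v * exp (-π * u ^ 2 / v ^ 2) / v) =
      ENNReal.ofReal (1 / u - 4 * ∑' n : ℕ, besselK 0 (2 * π * ((n : ℝ) + 1) * u)) := by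
  have hnn : 0 ≤ ∑' n : ℕ, besselK 0 (2 * π * ((n : ℝ) + 1) * u) :=
    tsum_nonneg fun n ↦ besselK_zero_nonneg _
  rw [ENNReal.ofReal_sub _ (by positivity), ← lintegral_thetaGap_gaussian_add hu,
    ENNReal.add_sub_cancel_right ENNReal.ofReal_ne_top]

theorem four_mul_tsum_besselK_le {u : ℝ} (hu : 0 < u) :
    4 * ∑' n : ℕ, besselK 0 (2 * π * ((n : ℝ) + 1) * u) ≤ 1 / u := by
  have h := lintegral_thetaGap_gaussian_add hu
  rw [← ENNReal.ofReal_le_ofReal_iff (by positivity), ← h]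
  exact le_add_self

/-! ### Binet's integral for the digamma function. -/

/-- The kernel `1 / u - 1 / (exp u - 1)` of Binet's integral for the digamma function. -/
noncomputable def binetKernel (u : ℝ) : ℝ := 1 / u - 1 / (exp u - 1)

theorem measurable_binetKernel : Measurable binetKernel := by
  unfold binetKernel
  fun_prop

theorem binetKernel_nonneg {u : ℝ} (hu : 0 < u) : 0 ≤ binetKernel u := by
  have h : u ≤ exp u - 1 := by linarith [add_one_le_exp u]
  exact sub_nonneg.2 (one_div_le_one_div_of_le hu h)

theorem binetKernel_le_one {u : ℝ} (hu : 0 < u) : binetKernel u ≤ 1 := by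
  have h : 0 < exp u - 1 := by linarith [add_one_lt_exp hu.ne']
  have h1 : (1 - u) * exp u ≤ 1 := by
    have h2 := one_sub_le_exp_neg u
    have := mul_le_mul_of_nonneg_right h2 (exp_pos u).le
    rwa [← exp_add, neg_add_cancel, exp_zero] at this
  rw [binetKernel, div_sub_div _ _ hu.ne' h.ne', div_le_one (by positivity)]
  nlinarith

theorem integrableOn_binetKernel_mul_exp {t : ℝ} (ht : 0 < t) :
    IntegrableOn (fun u ↦ binetKernel u * exp (-t * u)) (Ioi 0) := by
  refine Integrable.mono' (integrableOn_exp_mul_Ioi (a := -t) (by linarith) 0)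
    (measurable_binetKernel.mul (by fun_prop)).aestronglyMeasurable ?_
  filter_upwards [ae_restrict_mem measurableSet_Ioi] with u hu
  rw [Real.norm_of_nonneg (mul_nonneg (binetKernel_nonneg hu) (exp_pos _).le)]
  exact mul_le_of_le_one_left (exp_pos _).le (binetKernel_le_one hu)

theorem integral_exp_neg_mul_Ioi {t : ℝ} (ht : 0 < t) :
    ∫ u in Ioi (0 : ℝ), exp (-t * u) = 1 / t := by
  rw [integral_exp_mul_Ioi (by linarith)]
  simp

/-- The Laplace transform of `binetKernel`. -/
noncomputable def binetLaplace (t : ℝ) : ℝ := ∫ u in Ioi (0 : ℝ), binetKernel u * exp (-t * u)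

theorem binetLaplace_nonneg (t : ℝ) : 0 ≤ binetLaplace t :=
  setIntegral_nonneg measurableSet_Ioi fun _ hu ↦ mul_nonneg (binetKernel_nonneg hu) (exp_pos _).le

theorem binetLaplace_le {t : ℝ} (ht : 0 < t) : binetLaplace t ≤ 1 / t := by
  rw [← integral_exp_neg_mul_Ioi ht]
  refine setIntegral_mono_on (integrableOn_binetKernel_mul_exp ht)
    (integrableOn_exp_mul_Ioi (a := -t) (by linarith) 0) measurableSet_Ioi fun u hu ↦ ?_
  exact mul_le_of_le_one_left (exp_pos _).le (binetKernel_le_one hu)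

/-- The `1 / u` part of the difference is a Frullani integral, giving the logarithms; in the other
part `(1 - exp (-u)) / (exp u - 1) = exp (-u)`, giving `1 / (t + 1)`. -/
theorem binetLaplace_sub {t : ℝ} (ht : 0 < t) :
    binetLaplace t - binetLaplace (t + 1) = log (t + 1) - log t - 1 / (t + 1) := by
  have ht1 : 0 < t + 1 := by linarith
  have hI : IntegrableOn (fun u ↦ binetKernel u * exp (-t * u) - binetKernel u * exp (-(t + 1) * u))
      (Ioi 0) := (integrableOn_binetKernel_mul_exp ht).sub (integrableOn_binetKernel_mul_exp ht1)
  have hE : IntegrableOn (fun u : ℝ ↦ exp (-(t + 1) * u)) (Ioi 0) :=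
    integrableOn_exp_mul_Ioi (a := -(t + 1)) (by linarith) 0
  have hcongr : EqOn (fun u : ℝ ↦ u⁻¹ • (exp (-(t * u)) - exp (-((t + 1) * u))))
      (fun u : ℝ ↦ (binetKernel u * exp (-t * u) - binetKernel u * exp (-(t + 1) * u)) +
        exp (-(t + 1) * u)) (Ioi 0) := by
    intro u hu
    have hu : 0 < u := hu
    have h : exp u - 1 ≠ 0 := by linarith [add_one_lt_exp hu.ne']
    have h2 : exp (-t * u) = exp (-(t + 1) * u) * exp u := by rw [← exp_add]; ring_nf
    simp only [smul_eq_mul, binetKernel, neg_mul] at h2 ⊢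
    rw [h2]
    field_simp
    ring
  have hF := Frullani.integral_Ioi_eq (f := fun u : ℝ ↦ exp (-u)) (L := 1) (R := 0)
    ((Continuous.locallyIntegrable (by fun_prop)).locallyIntegrableOn _) ht ht1
    (by
      have : Tendsto (fun u : ℝ ↦ exp (-u)) (𝓝 0) (𝓝 (exp (-0))) :=
        Continuous.tendsto (by fun_prop) 0
      simpa using this.mono_left nhdsWithin_le_nhds)
    tendsto_exp_neg_atTop_nhds_zero
    ((hI.add hE).congr_fun hcongr.symm measurableSet_Ioi)
  rw [setIntegral_congr_fun measurableSet_Ioi hcongr, integral_add hI hE,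
    integral_sub (integrableOn_binetKernel_mul_exp ht) (integrableOn_binetKernel_mul_exp ht1),
    integral_exp_neg_mul_Ioi ht1, log_div ht1.ne' ht.ne'] at hF
  simp only [sub_zero, smul_eq_mul, mul_one] at hF
  simp only [binetLaplace]
  linarith

theorem digamma_ofReal {t : ℝ} (ht : 0 < t) :
    Complex.digamma (t : ℂ) = ((deriv Gamma t / Gamma t : ℝ) : ℂ) := by
  have hne : ∀ m : ℕ, t ≠ -m := fun m ↦ by
    have : (0 : ℝ) ≤ m := Nat.cast_nonneg m
    intro h; linarith
  have hneC : ∀ m : ℕ, (t : ℂ) ≠ -m := fun m ↦ by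
    exact_mod_cast hne m
  have h1 := (Complex.differentiableAt_Gamma _ hneC).hasDerivAt.comp_ofReal
  have h2 := (Real.differentiableAt_Gamma hne).hasDerivAt.ofReal_comp
  simp only [Complex.Gamma_ofReal] at h1
  rw [Complex.digamma_def, logDeriv_apply, h1.unique h2, Complex.Gamma_ofReal]
  push_cast
  rfl

/-- By convexity of `log Γ`, its derivative at `t + 1` lies between the slopes over the unit
intervals on either side, which the recurrence evaluates as logarithms. -/
theorem log_le_digamma {t : ℝ} (ht : 0 < t) :
    log t ≤ deriv Gamma (t + 1) / Gamma (t + 1) ∧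
      deriv Gamma (t + 1) / Gamma (t + 1) ≤ log (t + 1) := by
  have ht1 : 0 < t + 1 := by linarith
  have hne : ∀ m : ℕ, t + 1 ≠ -m := fun m ↦ by
    have : (0 : ℝ) ≤ m := Nat.cast_nonneg m
    intro h; linarith
  have hd : HasDerivAt (log ∘ Gamma) (deriv Gamma (t + 1) / Gamma (t + 1)) (t + 1) :=
    (Real.differentiableAt_Gamma hne).hasDerivAt.log (Gamma_pos_of_pos ht1).ne'
  have hstep : ∀ s : ℝ, 0 < s → (log ∘ Gamma) (s + 1) - (log ∘ Gamma) s = log s := by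
    intro s hs
    simp only [Function.comp]
    rw [Gamma_add_one hs.ne', log_mul hs.ne' (Gamma_pos_of_pos hs).ne']
    ring
  constructor
  · have := convexOn_log_Gamma.slope_le_of_hasDerivAt (x := t) (y := t + 1) ht
      ht1 (by linarith) hd
    rw [slope_def_field, hstep t ht] at this
    simpa using this
  · have := convexOn_log_Gamma.le_slope_of_hasDerivAt (x := t + 1) (y := t + 1 + 1) ht1
      (show t + 1 + 1 ∈ Ioi (0 : ℝ) from by simp only [mem_Ioi]; linarith) (by linarith) hd
    rw [slope_def_field, hstep (t + 1) ht1] at this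
    simpa using this

/-- Both sides satisfy the same recurrence, so their difference `d` is 1-periodic; it is also
bounded by `1 / s`, hence vanishes. -/
theorem digamma_add_one_sub_log {t : ℝ} (ht : 0 < t) :
    Complex.digamma ((t : ℂ) + 1) - (log t : ℂ) = (binetLaplace t : ℂ) := by
  set d : ℝ → ℝ := fun s ↦ deriv Gamma (s + 1) / Gamma (s + 1) - log s - binetLaplace s with hd
  have hdig : ∀ s : ℝ, 0 < s → Complex.digamma ((s : ℂ) + 1) =
      ((deriv Gamma (s + 1) / Gamma (s + 1) : ℝ) : ℂ) := by
    intro s hs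
    have := digamma_ofReal (t := s + 1) (by linarith)
    rw [← this]; push_cast; rfl
  have hper : ∀ s : ℝ, 0 < s → d (s + 1) = d s := by
    intro s hs
    have h1 := Complex.digamma_apply_add_one ((s : ℂ) + 1) (fun m h ↦ by
      have h2 := congrArg Complex.re h
      simp at h2
      have : (0 : ℝ) ≤ m := Nat.cast_nonneg m
      linarith)
    have h3 := hdig (s + 1) (by linarith)
    push_cast at h3
    rw [h3, hdig s hs] at h1
    have h4 : deriv Gamma (s + 1 + 1) / Gamma (s + 1 + 1) =
        deriv Gamma (s + 1) / Gamma (s + 1) + (s + 1)⁻¹ := by exact_mod_cast h1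
    have h5 := binetLaplace_sub hs
    simp only [hd, h4]
    rw [one_div] at h5
    linarith
  have hnat : ∀ n : ℕ, d (t + n) = d t := by
    intro n
    induction n with
    | zero => simp
    | succ n ih =>
      push_cast
      rw [← add_assoc, hper _ (by positivity), ih]
  have hbound : ∀ s : ℝ, 0 < s → |d s| ≤ 1 / s := by
    intro s hs
    obtain ⟨h1, h2⟩ := log_le_digamma hs
    have h3 := binetLaplace_nonneg s
    have h4 := binetLaplace_le hs
    have h5 : log (s + 1) - log s ≤ 1 / s := by
      rw [← log_div (by linarith) hs.ne']
      have := log_le_sub_one_of_pos (x := (s + 1) / s) (by positivity)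
      have h6 : (s + 1) / s - 1 = 1 / s := by field_simp; ring
      linarith
    rw [abs_le]
    constructor <;> simp only [hd] <;> linarith
  have hlim : Tendsto (fun n : ℕ ↦ 1 / (t + n)) atTop (𝓝 0) := by
    simp only [one_div]
    exact tendsto_inv_atTop_zero.comp
      (tendsto_atTop_add_const_left _ _ tendsto_natCast_atTop_atTop)
  have h0 : |d t| ≤ 0 := by
    refine ge_of_tendsto' hlim fun n ↦ ?_
    rw [← hnat n]
    exact hbound _ (by positivity)
  have h00 : d t = 0 := abs_nonpos_iff.1 h0
  rw [hdig t ht, ← Complex.ofReal_sub]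
  congr 1
  simp only [hd] at h00
  linarith

/-! ### The Gaussian transform of the digamma factor. -/

theorem lintegral_Ioi_mul_left {c : ℝ} (hc : 0 < c) (f : ℝ → ENNReal) :
    ∫⁻ t in Ioi (0 : ℝ), f t = ENNReal.ofReal c * ∫⁻ s in Ioi (0 : ℝ), f (c * s) := by
  have h := lintegral_image_eq_lintegral_abs_deriv_mul (s := Ioi (0 : ℝ)) measurableSet_Ioi
    (f := fun x ↦ c * x) (f' := fun _ ↦ c)
    (fun x _ ↦ ((hasDerivAt_id x).const_mul c).hasDerivWithinAt.congr_deriv (by simp))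
    ((mul_right_injective₀ hc.ne').injOn) f
  rw [image_mul_left_Ioi hc, mul_zero] at h
  rw [h, lintegral_const_mul' _ _ ENNReal.ofReal_ne_top, abs_of_pos hc]

theorem lintegral_mul_exp_neg_mul_sq {A : ℝ} (hA : 0 < A) :
    ∫⁻ w in Ioi (0 : ℝ), ENNReal.ofReal (w * exp (-A * w ^ 2)) = ENNReal.ofReal (1 / (2 * A)) := by
  have hnn : ∀ᵐ w ∂(volume.restrict (Ioi (0 : ℝ))), 0 ≤ w * exp (-A * w ^ 2) := by
    filter_upwards [ae_restrict_mem measurableSet_Ioi] with w hw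
    have hw : 0 < w := hw
    positivity
  rw [← ofReal_integral_eq_lintegral_ofReal (integrable_mul_exp_neg_mul_sq hA).integrableOn hnn]
  congr 1
  have h := integral_rpow_mul_exp_neg_mul_rpow (p := 2) (q := 1) (b := A) two_pos (by norm_num) hA
  simp only [rpow_one, rpow_two] at h
  rw [h]
  norm_num [rpow_neg_one]

theorem lintegral_sq_mul_exp_neg_mul_sq {A : ℝ} (hA : 0 < A) :
    ∫⁻ p in Ioi (0 : ℝ), ENNReal.ofReal (p ^ 2 * exp (-(π * A) * p ^ 2)) =
      ENNReal.ofReal (1 / (4 * π * (A * √A))) := by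
  have hb : 0 < π * A := by positivity
  have hint : IntegrableOn (fun p : ℝ ↦ p ^ 2 * exp (-(π * A) * p ^ 2)) (Ioi 0) := by
    have := integrableOn_rpow_mul_exp_neg_mul_sq hb (s := 2) (by norm_num)
    simpa only [rpow_two] using this
  rw [← ofReal_integral_eq_lintegral_ofReal hint (ae_of_all _ fun p ↦ by positivity)]
  congr 1
  have h := integral_rpow_mul_exp_neg_mul_rpow (p := 2) (q := 2) (b := π * A) two_pos
    (by norm_num) hb
  simp only [rpow_two] at h
  rw [h]
  have hG : Gamma ((2 + 1) / 2) = √π / 2 := by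
    rw [show ((2 : ℝ) + 1) / 2 = 1 / 2 + 1 by norm_num, Gamma_add_one (by norm_num),
      Real.Gamma_one_half_eq]
    ring
  have hpow : (π * A) ^ (-(2 + 1) / 2 : ℝ) = 1 / ((π * A) * (√π * √A)) := by
    rw [show (-(2 + 1) / 2 : ℝ) = -(1 + 1 / 2) by norm_num, rpow_neg hb.le, rpow_add hb,
      rpow_one, ← sqrt_eq_rpow, sqrt_mul pi_pos.le, one_div]
  rw [hG, hpow]
  have h1 := Real.sqrt_pos.2 pi_pos
  have h2 := Real.sqrt_pos.2 hA
  field_simp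
  norm_num

/-- Partial fractions of the hyperbolic cotangent, in terms of `binetKernel`. -/
theorem hasSum_two_mul_div_sq_add_sq {p : ℝ} (hp : 0 < p) :
    HasSum (fun n : ℕ ↦ 2 * p / (p ^ 2 + ((n : ℝ) + 1) ^ 2))
      (π - 2 * π * binetKernel (2 * π * p)) := by
  -- The cotangent series is taken at `ip`, where `i * π * cot (π * i * p) = π * coth (π * p) = π +
  -- 2 * π / (exp (2 * π * p) - 1)`.
  have hz : (Complex.I * p : ℂ) ∈ Complex.integerComplement := by
    rw [Complex.mem_integerComplement_iff]
    rintro ⟨n, hn⟩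
    have := congrArg Complex.im hn
    simp at this
    exact hp.ne this
  have hsum : HasSum (fun n : ℕ ↦ cotTerm (Complex.I * p) n)
      (π * Complex.cot (π * (Complex.I * p)) - 1 / (Complex.I * p)) := by
    have h1 := (summable_cotTerm hz).hasSum
    rwa [show (∑' n : ℕ, cotTerm (Complex.I * p) n) = _ from (cot_series_rep' hz).symm] at h1
  have h2 := hsum.mul_left Complex.I
  rw [← Complex.hasSum_ofReal]
  have hexp : 0 < exp (2 * π * p) - 1 := by
    have : 0 < 2 * π * p := by positivity
    linarith [add_one_lt_exp this.ne']
  have hpC : (p : ℂ) ≠ 0 := by exact_mod_cast hp.ne'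
  have hval : ((π - 2 * π * binetKernel (2 * π * p) : ℝ) : ℂ) =
      Complex.I * (π * Complex.cot (π * (Complex.I * p)) - 1 / (Complex.I * p)) := by
    have he : Complex.exp (2 * Complex.I * (π * (Complex.I * p))) =
        ((1 / exp (2 * π * p) : ℝ) : ℂ) := by
      rw [one_div, ← exp_neg, Complex.ofReal_exp]
      congr 1
      push_cast
      ring_nf
      rw [Complex.I_sq]
      ring
    rw [Complex.cot_eq_exp_ratio, he, mul_sub]
    have h3 : Complex.I * (1 / (Complex.I * p)) = 1 / (p : ℂ) := by
      field_simp
    have h4 : Complex.I * (π * ((((1 / exp (2 * π * p) : ℝ) : ℂ) + 1) /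
        (Complex.I * (1 - ((1 / exp (2 * π * p) : ℝ) : ℂ))))) =
        π * ((((1 / exp (2 * π * p) : ℝ) : ℂ) + 1) / (1 - ((1 / exp (2 * π * p) : ℝ) : ℂ))) := by
      rw [← div_div]
      field_simp
    rw [h3, h4]
    norm_cast
    rw [binetKernel]
    have h5 := exp_pos (2 * π * p)
    have h6 : 1 - 1 / exp (2 * π * p) = (exp (2 * π * p) - 1) / exp (2 * π * p) := by
      field_simp
    rw [h6]
    have h7 := hexp.ne'
    generalize exp (2 * π * p) = E at *
    field_simp
    ring
  rw [hval]
  refine h2.congr_fun fun n ↦ ?_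
  rw [cotTerm_identity hz]
  have h7 : (Complex.I * p + (n + 1)) * (Complex.I * p - (n + 1)) =
      -((p ^ 2 + ((n : ℝ) + 1) ^ 2 : ℝ) : ℂ) := by
    push_cast
    ring_nf
    rw [Complex.I_sq]
    ring
  have h8 : ((p ^ 2 + ((n : ℝ) + 1) ^ 2 : ℝ) : ℂ) ≠ 0 := by
    exact_mod_cast (by positivity : p ^ 2 + ((n : ℝ) + 1) ^ 2 ≠ 0)
  rw [h7, Complex.ofReal_div]
  field_simp
  push_cast
  linear_combination (2 * p : ℂ) * Complex.I_sq

/-- `binetKernel` as a Gaussian transform of `thetaGap`. -/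
theorem lintegral_thetaGap_mul_gaussian {p : ℝ} (hp : 0 < p) :
    ∫⁻ w in Ioi (0 : ℝ), ENNReal.ofReal (2 * π * p * (w * exp (-π * p ^ 2 * w ^ 2)) * thetaGap w) =
      ENNReal.ofReal (2 * π * binetKernel (2 * π * p)) := by
  have hm := measurable_thetaGap
  have hS := hasSum_two_mul_div_sq_add_sq hp
  have hk := binetKernel_nonneg (u := 2 * π * p) (by positivity)
  have hSnn : 0 ≤ π - 2 * π * binetKernel (2 * π * p) := hS.nonneg fun n ↦ by positivity
  -- Here `thetaGap` is `1 / w` minus its Gaussian series: the first part contributes `π`, and the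
  -- series integrates termwise to the cotangent partial fractions.
  have htot : ∫⁻ w in Ioi (0 : ℝ), ENNReal.ofReal (2 * π * p * (w * exp (-π * p ^ 2 * w ^ 2)) * (1 / w))
      = ENNReal.ofReal π := by
    have h1 : ∫⁻ w in Ioi (0 : ℝ), ENNReal.ofReal (2 * π * p * exp (-(π * p ^ 2) * w ^ 2)) =
        ENNReal.ofReal π := by
      rw [← ofReal_integral_eq_lintegral_ofReal
        ((integrable_exp_neg_mul_sq (by positivity)).integrableOn.const_mul _)
        (ae_of_all _ fun p ↦ by positivity), integral_const_mul, integral_gaussian_Ioi]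
      congr 1
      rw [Real.sqrt_div' _ (by positivity), Real.sqrt_mul' _ (sq_nonneg p), Real.sqrt_sq hp.le]
      have := Real.sqrt_pos.2 Real.pi_pos
      field_simp
    rw [← h1]
    refine setLIntegral_congr_fun measurableSet_Ioi fun w hw ↦ ?_
    have hw : 0 < w := hw
    congr 1
    field_simp
  have hser : ∫⁻ w in Ioi (0 : ℝ), ENNReal.ofReal
      (2 * π * p * (w * exp (-π * p ^ 2 * w ^ 2)) * (1 / w - thetaGap w)) =
      ENNReal.ofReal (π - 2 * π * binetKernel (2 * π * p)) := by
    rw [← hS.tsum_eq, ENNReal.ofReal_tsum_of_nonneg (fun n ↦ by positivity) hS.summable]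
    have hterm : ∀ n : ℕ, ENNReal.ofReal (2 * p / (p ^ 2 + ((n : ℝ) + 1) ^ 2)) =
        ∫⁻ w in Ioi (0 : ℝ), ENNReal.ofReal (4 * π * p) *
          ENNReal.ofReal (w * exp (-(π * (p ^ 2 + ((n : ℝ) + 1) ^ 2)) * w ^ 2)) := by
      intro n
      rw [lintegral_const_mul _ (by fun_prop), lintegral_mul_exp_neg_mul_sq (by positivity),
        ← ENNReal.ofReal_mul (by positivity)]
      congr 1
      field_simp
      ring
    simp_rw [hterm]
    rw [← lintegral_tsum (fun n ↦ by fun_prop)]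
    refine setLIntegral_congr_fun measurableSet_Ioi fun w hw ↦ ?_
    have hw : 0 < w := hw
    have hs := (hasSum_gaussian_thetaGap hw).mul_left (2 * π * p * (w * exp (-π * p ^ 2 * w ^ 2)))
    rw [← hs.tsum_eq, ENNReal.ofReal_tsum_of_nonneg (fun n ↦ by positivity) hs.summable]
    refine tsum_congr fun n ↦ ?_
    rw [← ENNReal.ofReal_mul (by positivity)]
    congr 1
    rw [show -(π * (p ^ 2 + ((n : ℝ) + 1) ^ 2)) * w ^ 2 =
      -π * p ^ 2 * w ^ 2 + -π * ((n : ℝ) + 1) ^ 2 * w ^ 2 by ring, exp_add]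
    ring
  have hadd : (∫⁻ w in Ioi (0 : ℝ),
      ENNReal.ofReal (2 * π * p * (w * exp (-π * p ^ 2 * w ^ 2)) * thetaGap w)) +
      ENNReal.ofReal (π - 2 * π * binetKernel (2 * π * p)) = ENNReal.ofReal π := by
    rw [← hser, ← htot, ← lintegral_add_left (by fun_prop)]
    refine setLIntegral_congr_fun measurableSet_Ioi fun w hw ↦ ?_
    have hw : 0 < w := hw
    have h0 := thetaGap_nonneg hw
    have h1 := sub_nonneg.2 (thetaGap_le_inv hw)
    rw [← ENNReal.ofReal_add (by positivity) (by positivity)]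
    congr 1
    ring
  have h2 : ENNReal.ofReal π = ENNReal.ofReal (2 * π * binetKernel (2 * π * p)) +
      ENNReal.ofReal (π - 2 * π * binetKernel (2 * π * p)) := by
    rw [← ENNReal.ofReal_add (by positivity) hSnn]
    congr 1
    ring
  rw [h2] at hadd
  exact (ENNReal.add_left_inj ENNReal.ofReal_ne_top).1 hadd

/-- For `c = b² w² - 1 ≠ 0`, an antiderivative of `Q ^ (-3/2)` is `(b² τ + 1) / (c √Q)`. When `b * w
= 1` the quadratic is the square of `w + b * τ`, and `-1 / (2 * b * Q)` serves instead. -/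
theorem lintegral_inv_quadratic_rpow {w b : ℝ} (hw : 0 < w) (hb : 0 < b) :
    ∫⁻ τ in Ioi (0 : ℝ), ENNReal.ofReal (1 / ((w ^ 2 + 2 * τ + b ^ 2 * τ ^ 2) *
      √(w ^ 2 + 2 * τ + b ^ 2 * τ ^ 2))) = ENNReal.ofReal (1 / (w * (1 + b * w))) := by
  set Q : ℝ → ℝ := fun τ ↦ w ^ 2 + 2 * τ + b ^ 2 * τ ^ 2 with hQ
  have hQpos : ∀ τ : ℝ, 0 ≤ τ → 0 < Q τ := fun τ hτ ↦ by simp only [hQ]; positivity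
  have hQd : ∀ τ : ℝ, HasDerivAt Q (2 * (1 + b ^ 2 * τ)) τ := by
    intro τ
    have h1 := (((hasDerivAt_id τ).const_mul 2).const_add (w ^ 2)).add
      (((hasDerivAt_id τ).pow 2).const_mul (b ^ 2))
    refine h1.congr_deriv ?_
    simp only [id, Nat.cast_ofNat, mul_one, Nat.add_one_sub_one, pow_one]
    ring
  have hQlim : Tendsto Q atTop atTop := by
    refine tendsto_atTop_mono' atTop ?_ tendsto_id
    filter_upwards [eventually_ge_atTop 0] with τ hτ
    simp only [hQ, id]
    nlinarith [sq_nonneg w, mul_nonneg (sq_nonneg b) (sq_nonneg τ)]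
  have hnn : ∀ τ ∈ Ioi (0 : ℝ), 0 ≤ 1 / (Q τ * √(Q τ)) := fun τ hτ ↦ by
    have := hQpos τ (le_of_lt hτ)
    positivity
  suffices h : ∃ f : ℝ → ℝ, (∀ τ ∈ Ici (0 : ℝ), HasDerivAt f (1 / (Q τ * √(Q τ))) τ) ∧
      ∃ l, Tendsto f atTop (𝓝 l) ∧ l - f 0 = 1 / (w * (1 + b * w)) by
    obtain ⟨f, hf, l, hl, hval⟩ := h
    rw [← hval, ← integral_Ioi_of_hasDerivAt_of_nonneg' hf hnn hl]
    exact (ofReal_integral_eq_lintegral_ofReal (integrableOn_Ioi_deriv_of_nonneg' hf hnn hl)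
      ((ae_restrict_iff' measurableSet_Ioi).2 (ae_of_all _ hnn))).symm
  by_cases hbw : b * w = 1
  · have hQ2 : ∀ τ, Q τ = (w + b * τ) ^ 2 := by
      intro τ
      simp only [hQ]
      linear_combination (-2 * τ) * hbw
    refine ⟨fun τ ↦ -(1 / (2 * b)) * (Q τ)⁻¹, fun τ hτ ↦ ?_, 0, ?_, ?_⟩
    · have hpos := hQpos τ hτ
      have h1 := ((hQd τ).inv hpos.ne').const_mul (-(1 / (2 * b)))
      refine h1.congr_deriv ?_
      have hτ : 0 ≤ τ := hτ
      have hs : 0 < w + b * τ := by positivity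
      have h2 : 1 + b ^ 2 * τ = b * (w + b * τ) := by linear_combination -hbw
      rw [h2, hQ2, sqrt_sq hs.le]
      field_simp
    · have := (tendsto_inv_atTop_zero.comp hQlim).const_mul (-(1 / (2 * b)))
      simpa using this
    · rw [hbw]
      simp only [hQ]
      have : b = 1 / w := by field_simp; exact hbw
      rw [this]
      field_simp
      ring
  · set c := b ^ 2 * w ^ 2 - 1 with hc
    have hbw1 : b * w - 1 ≠ 0 := sub_ne_zero.2 hbw
    have hc2 : c = (b * w - 1) * (1 + b * w) := by rw [hc]; ring
    have hc0 : c ≠ 0 := by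
      rw [hc2]
      exact mul_ne_zero hbw1 (by positivity)
    -- Completing the square drives both the derivative check and the limit at infinity.
    have hid : ∀ τ, (b ^ 2 * τ + 1) ^ 2 = b ^ 2 * Q τ - c := by
      intro τ
      simp only [hQ, hc]
      ring
    refine ⟨fun τ ↦ 1 / c * ((b ^ 2 * τ + 1) / √(Q τ)), fun τ hτ ↦ ?_, 1 / c * b, ?_, ?_⟩
    · have hpos := hQpos τ hτ
      have hs := Real.sqrt_pos.2 hpos
      have h1 := ((((hasDerivAt_id τ).const_mul (b ^ 2)).add_const 1).div
        ((hQd τ).sqrt hpos.ne') hs.ne').const_mul (1 / c)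
      refine h1.congr_deriv ?_
      simp only [id, mul_one]
      have hsq : √(Q τ) ^ 2 = Q τ := Real.sq_sqrt hpos.le
      have hq : b ^ 2 * √(Q τ) ^ 2 - (b ^ 2 * τ + 1) ^ 2 = c := by rw [hid, hsq]; ring
      generalize √(Q τ) = R at *
      rw [← hsq]
      field_simp
      linear_combination hq
    · refine Tendsto.const_mul _ ?_
      have h1 : Tendsto (fun τ ↦ √(b ^ 2 - c * (Q τ)⁻¹)) atTop (𝓝 b) := by
        have h2 := ((tendsto_inv_atTop_zero.comp hQlim).const_mul c).const_sub (b ^ 2)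
        have h3 := h2.sqrt
        simpa [Real.sqrt_sq hb.le] using h3
      refine h1.congr' ?_
      filter_upwards [eventually_ge_atTop 0] with τ hτ
      have hpos := hQpos τ hτ
      have h4 : b ^ 2 - c * (Q τ)⁻¹ = (b ^ 2 * τ + 1) ^ 2 / Q τ := by
        rw [hid]; field_simp
      rw [h4, sqrt_div (sq_nonneg _), sqrt_sq (by positivity)]
    · have h0 : √(Q 0) = w := by
        simp only [hQ]
        rw [← sqrt_sq hw.le]
        congr 1
        rw [sqrt_sq hw.le]
        ring
      simp only [h0]
      rw [hc2]
      field_simp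
      ring

/-- A Gaussian integral over a quadrant. -/
theorem lintegral_quadrant_gaussian {w b : ℝ} (hw : 0 < w) (hb : 0 < b) :
    ∫⁻ t in Ioi (0 : ℝ), ∫⁻ p in Ioi (0 : ℝ), ENNReal.ofReal
      (p * exp (-π * (w ^ 2 * p ^ 2 + 2 * t * p + b ^ 2 * t ^ 2))) =
      ENNReal.ofReal (1 / (4 * π * (w * (1 + b * w)))) := by
  rw [lintegral_lintegral_swap (by fun_prop)]
  -- Substituting `t = p * τ` makes the exponent a multiple of `p ^ 2`, so the `p`-integral becomes
  -- a Gaussian second moment.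
  have h1 : ∀ p ∈ Ioi (0 : ℝ), ∫⁻ t in Ioi (0 : ℝ), ENNReal.ofReal
      (p * exp (-π * (w ^ 2 * p ^ 2 + 2 * t * p + b ^ 2 * t ^ 2))) =
      ∫⁻ τ in Ioi (0 : ℝ), ENNReal.ofReal
        (p ^ 2 * exp (-(π * (w ^ 2 + 2 * τ + b ^ 2 * τ ^ 2)) * p ^ 2)) := by
    intro p hp
    have hp : 0 < p := hp
    rw [lintegral_Ioi_mul_left hp, ← lintegral_const_mul _ (by fun_prop)]
    refine lintegral_congr fun τ ↦ ?_
    rw [← ENNReal.ofReal_mul hp.le, ← mul_assoc, ← sq]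
    congr 3
    ring
  rw [setLIntegral_congr_fun measurableSet_Ioi h1, lintegral_lintegral_swap (by fun_prop)]
  have h2 : ∀ τ ∈ Ioi (0 : ℝ), ∫⁻ p in Ioi (0 : ℝ), ENNReal.ofReal
        (p ^ 2 * exp (-(π * (w ^ 2 + 2 * τ + b ^ 2 * τ ^ 2)) * p ^ 2)) =
      ENNReal.ofReal (1 / (4 * π)) * ENNReal.ofReal (1 / ((w ^ 2 + 2 * τ + b ^ 2 * τ ^ 2) *
        √(w ^ 2 + 2 * τ + b ^ 2 * τ ^ 2))) := by
    intro τ hτ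
    have hτ : 0 < τ := hτ
    rw [lintegral_sq_mul_exp_neg_mul_sq (by positivity), ← ENNReal.ofReal_mul (by positivity)]
    congr 1
    rw [one_div_mul_one_div]
  rw [setLIntegral_congr_fun measurableSet_Ioi h2, lintegral_const_mul _ (by fun_prop),
    lintegral_inv_quadratic_rpow hw hb, ← ENNReal.ofReal_mul (by positivity), one_div_mul_one_div]

/-- The scaling `u = 2 * π * p` matches the Gaussian representation of `binetKernel`. -/
theorem ofReal_binetLaplace {t : ℝ} (ht : 0 < t) :
    ENNReal.ofReal (binetLaplace t) = ∫⁻ p in Ioi (0 : ℝ), ∫⁻ w in Ioi (0 : ℝ),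
      ENNReal.ofReal (2 * π * p * (w * exp (-π * p ^ 2 * w ^ 2)) * thetaGap w *
        exp (-(2 * π * t * p))) := by
  have hm := measurable_thetaGap
  have hk := measurable_binetKernel
  rw [binetLaplace, ofReal_integral_eq_lintegral_ofReal (integrableOn_binetKernel_mul_exp ht)
    ((ae_restrict_iff' measurableSet_Ioi).2 (ae_of_all _ fun u hu ↦
      mul_nonneg (binetKernel_nonneg hu) (exp_pos _).le)),
    lintegral_Ioi_mul_left (c := 2 * π) (by positivity), ← lintegral_const_mul _ (by fun_prop)]
  refine setLIntegral_congr_fun measurableSet_Ioi fun p hp ↦ ?_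
  have hp : 0 < p := hp
  have h0 := binetKernel_nonneg (u := 2 * π * p) (by positivity)
  have h1 : ∀ w ∈ Ioi (0 : ℝ), ENNReal.ofReal (2 * π * p * (w * exp (-π * p ^ 2 * w ^ 2)) *
      thetaGap w * exp (-(2 * π * t * p))) =
      ENNReal.ofReal (2 * π * p * (w * exp (-π * p ^ 2 * w ^ 2)) * thetaGap w) *
      ENNReal.ofReal (exp (-(2 * π * t * p))) := by
    intro w hw
    exact ENNReal.ofReal_mul' (exp_pos _).le
  rw [setLIntegral_congr_fun measurableSet_Ioi h1, lintegral_mul_const _ (by fun_prop),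
    lintegral_thetaGap_mul_gaussian hp, ← ENNReal.ofReal_mul (by positivity),
    ← ENNReal.ofReal_mul (by positivity)]
  congr 1
  ring_nf

/-- The Gaussian transform of `ψ(t + 1) - log t`. -/
theorem lintegral_binetLaplace_mul_gaussian {b : ℝ} (hb : 0 < b) :
    ∫⁻ t in Ioi (0 : ℝ), ENNReal.ofReal (binetLaplace t) *
      ENNReal.ofReal (exp (-π * (b ^ 2 * t ^ 2))) =
      ∫⁻ w in Ioi (0 : ℝ), ENNReal.ofReal (thetaGap w / (2 * (1 + b * w))) := by
  have hm := measurable_thetaGap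
  have h1 : ∀ t ∈ Ioi (0 : ℝ), ENNReal.ofReal (binetLaplace t) *
      ENNReal.ofReal (exp (-π * (b ^ 2 * t ^ 2))) =
      ∫⁻ w in Ioi (0 : ℝ), ∫⁻ p in Ioi (0 : ℝ), ENNReal.ofReal (2 * π * w * thetaGap w) *
        ENNReal.ofReal (p * exp (-π * (w ^ 2 * p ^ 2 + 2 * t * p + b ^ 2 * t ^ 2))) := by
    intro t ht
    rw [ofReal_binetLaplace ht, lintegral_lintegral_swap (by fun_prop),
      ← lintegral_mul_const' _ _ ENNReal.ofReal_ne_top]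
    refine setLIntegral_congr_fun measurableSet_Ioi fun w hw ↦ ?_
    have hw : 0 < w := hw
    have h0 := thetaGap_nonneg hw
    rw [← lintegral_mul_const' _ _ ENNReal.ofReal_ne_top]
    refine setLIntegral_congr_fun measurableSet_Ioi fun p hp ↦ ?_
    rw [← ENNReal.ofReal_mul' (exp_pos _).le, ← ENNReal.ofReal_mul (by positivity)]
    congr 1
    rw [show -π * (w ^ 2 * p ^ 2 + 2 * t * p + b ^ 2 * t ^ 2) =
      -π * p ^ 2 * w ^ 2 + -(2 * π * t * p) + -π * (b ^ 2 * t ^ 2) by ring, exp_add, exp_add]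
    ring
  rw [setLIntegral_congr_fun measurableSet_Ioi h1, lintegral_lintegral_swap (by fun_prop)]
  refine setLIntegral_congr_fun measurableSet_Ioi fun w hw ↦ ?_
  have hw : 0 < w := hw
  have h0 := thetaGap_nonneg hw
  simp only [lintegral_const_mul' _ _ ENNReal.ofReal_ne_top]
  rw [lintegral_quadrant_gaussian hw hb, ← ENNReal.ofReal_mul (by positivity)]
  congr 1
  field_simp
  ring

/-! ### The Fourier transform of the hyperbolic secant. -/

/-- With `y = exp r / (1 + exp r)` this is the Beta integral `B(s, 1 - s)` at `s = 1/2 + it`,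
evaluated by Euler's reflection formula with `sin (π * s) = cosh (π * t)`. -/
theorem integral_cexp_div_one_add_exp (t : ℝ) :
    ∫ r : ℝ, Complex.exp (Complex.I * t * r) * ((exp (r / 2) / (1 + exp r) : ℝ) : ℂ) =
      ((π / cosh (π * t) : ℝ) : ℂ) := by
  set s : ℂ := 1 / 2 + Complex.I * t with hs
  have hre : s.re = 1 / 2 := by simp [hs]
  have hre1 : (1 - s).re = 1 / 2 := by simp [hs]; norm_num
  have hbeta := Complex.Gamma_mul_Gamma_eq_betaIntegral (s := s) (t := 1 - s)
    (by rw [hre]; norm_num) (by rw [hre1]; norm_num)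
  rw [Complex.Gamma_mul_Gamma_one_sub, add_sub_cancel, Complex.Gamma_one, one_mul] at hbeta
  have hsin : Complex.sin (π * s) = ((cosh (π * t) : ℝ) : ℂ) := by
    rw [hs, mul_add, mul_one_div, add_comm, Complex.sin_add_pi_div_two,
      show (π : ℂ) * (Complex.I * t) = (π * t : ℂ) * Complex.I by ring, Complex.cos_mul_I]
    push_cast
    rfl
  rw [hsin] at hbeta
  push_cast at hbeta ⊢
  rw [hbeta, Complex.betaIntegral, intervalIntegral.integral_of_le zero_le_one,
    integral_Ioc_eq_integral_Ioo]
  have hd : ∀ r : ℝ, HasDerivAt (fun r : ℝ ↦ exp r / (1 + exp r)) (exp r / (1 + exp r) ^ 2) r := by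
    intro r
    have hpos : (1 + exp r) ≠ 0 := by positivity
    refine ((Real.hasDerivAt_exp r).div ((Real.hasDerivAt_exp r).const_add 1) hpos).congr_deriv ?_
    field_simp
    ring
  have hinj : Function.Injective (fun r : ℝ ↦ exp r / (1 + exp r)) := by
    intro a b hab
    have h1 := exp_pos a
    have h2 := exp_pos b
    simp only at hab
    rw [div_eq_div_iff (by positivity) (by positivity)] at hab
    exact exp_injective (by linarith)
  have himg : (fun r : ℝ ↦ exp r / (1 + exp r)) '' univ = Ioo 0 1 := by
    rw [image_univ]
    ext y
    constructor
    · rintro ⟨r, rfl⟩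
      have := exp_pos r
      exact ⟨by positivity, (div_lt_one (by positivity)).2 (by linarith)⟩
    · rintro ⟨h0, h1⟩
      have h2 : 0 < 1 - y := by linarith
      refine ⟨log (y / (1 - y)), ?_⟩
      simp only
      rw [exp_log (by positivity)]
      field_simp
      ring
  have hcv := integral_image_eq_integral_abs_deriv_smul MeasurableSet.univ
    (fun r _ ↦ (hd r).hasDerivWithinAt) hinj.injOn
    (fun x : ℝ ↦ (x : ℂ) ^ (s - 1) * (1 - (x : ℂ)) ^ (1 - s - 1))
  rw [himg, Measure.restrict_univ] at hcv
  rw [hcv]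
  refine integral_congr_ae (ae_of_all _ fun r ↦ ?_)
  have hE := exp_pos r
  have hE1 : 0 < 1 + exp r := by positivity
  have h1 : (1 - ((exp r / (1 + exp r) : ℝ) : ℂ)) = ((1 / (1 + exp r) : ℝ) : ℂ) := by
    rw [← Complex.ofReal_one, ← Complex.ofReal_sub]
    congr 1
    field_simp
    ring
  have hc : ∀ (x : ℝ) (hx : 0 < x) (a : ℂ), (x : ℂ) ^ a = Complex.exp (log x * a) := by
    intro x hx a
    rw [Complex.cpow_def_of_ne_zero (by exact_mod_cast hx.ne'), ← Complex.ofReal_log hx.le]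
  have hofexp : ∀ x : ℝ, 0 < x → (x : ℂ) = Complex.exp (log x) := by
    intro x hx
    rw [← Complex.ofReal_exp, exp_log hx]
  have hL : Complex.exp (r / 2) / (1 + Complex.exp r) =
      Complex.exp ((r / 2 - log (1 + exp r) : ℝ) : ℂ) := by
    have := hofexp (exp (r / 2) / (1 + exp r)) (by positivity)
    rw [log_div (by positivity) hE1.ne', log_exp] at this
    rw [← this]
    push_cast
    rfl
  simp only
  rw [hL, abs_of_pos (by positivity), h1, hc _ (by positivity), hc _ (by positivity),
    Complex.real_smul, hofexp (exp r / (1 + exp r) ^ 2) (by positivity),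
    log_div hE.ne' hE1.ne', log_div hE.ne' (by positivity), log_div one_ne_zero hE1.ne', log_exp,
    log_one, log_pow, ← Complex.exp_add, ← Complex.exp_add, ← Complex.exp_add, hs]
  generalize log (1 + exp r) = L
  congr 1
  push_cast
  ring

/-- The hyperbolic secant is self-dual under the Fourier transform. -/
theorem integral_cexp_div_cosh (a : ℝ) :
    ∫ t : ℝ, Complex.exp (Complex.I * a * t) * ((1 / cosh (π * t) : ℝ) : ℂ) =
      ((1 / cosh (a / 2) : ℝ) : ℂ) := by
  have h := integral_cexp_div_one_add_exp (a / (2 * π))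
  have hsc := Measure.integral_comp_mul_left (fun r : ℝ ↦ Complex.exp (Complex.I *
    ((a / (2 * π) : ℝ) : ℂ) * r) * ((exp (r / 2) / (1 + exp r) : ℝ) : ℂ)) (2 * π)
  rw [h, abs_of_pos (by positivity)] at hsc
  have hcongr : ∀ t : ℝ, Complex.exp (Complex.I * a * t) * ((1 / cosh (π * t) : ℝ) : ℂ) =
      2 * (Complex.exp (Complex.I * ((a / (2 * π) : ℝ) : ℂ) * ((2 * π * t : ℝ) : ℂ)) *
        ((exp (2 * π * t / 2) / (1 + exp (2 * π * t)) : ℝ) : ℂ)) := by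
    intro t
    have h1 : Complex.I * ((a / (2 * π) : ℝ) : ℂ) * ((2 * π * t : ℝ) : ℂ) =
        Complex.I * a * t := by
      have : (π : ℂ) ≠ 0 := by exact_mod_cast pi_ne_zero
      push_cast
      field_simp
    have h2 : 1 / cosh (π * t) = 2 * (exp (2 * π * t / 2) / (1 + exp (2 * π * t))) := by
      rw [cosh_eq, show 2 * π * t = π * t + π * t by ring, exp_add, exp_neg,
        show (π * t + π * t) / 2 = π * t by ring]
      have := exp_pos (π * t)
      field_simp
      ring
    rw [h1, h2]
    push_cast
    ring
  simp_rw [hcongr]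
  rw [integral_const_mul, hsc, Complex.real_smul]
  rw [show π * (a / (2 * π)) = a / 2 by field_simp]
  have : (π : ℂ) ≠ 0 := by exact_mod_cast pi_ne_zero
  push_cast
  field_simp

theorem integrable_one_div_cosh : Integrable fun t : ℝ ↦ 1 / cosh (π * t) := by
  refine Integrable.mono' ((integrable_exp_neg_mul_abs pi_pos).const_mul 2) ?_
    (ae_of_all _ fun t ↦ ?_)
  · exact (Continuous.div continuous_const (by fun_prop)
      fun t ↦ (cosh_pos _).ne').aestronglyMeasurable
  · have h0 := cosh_pos (π * t)
    rw [Real.norm_of_nonneg (by positivity), ← cosh_abs, abs_mul, abs_of_pos pi_pos,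
      div_le_iff₀ (cosh_pos _), cosh_eq]
    have h1 : exp (-π * |t|) * exp (π * |t|) = 1 := by rw [← exp_add]; simp
    have h2 : 0 ≤ exp (-π * |t|) * exp (-(π * |t|)) := by positivity
    linarith

theorem measurable_binetLaplace : Measurable binetLaplace := by
  have hk := measurable_binetKernel
  have h : StronglyMeasurable (Function.uncurry fun t u : ℝ ↦ binetKernel u * exp (-t * u)) :=
    Measurable.stronglyMeasurable (by fun_prop)
  exact h.integral_prod_right.measurable

/-! ### The theta pairing and the digamma–Bessel side. -/

/-- The double integral both sides of the identity reduce to. -/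
noncomputable def thetaGapPairing (x : ℝ) : ℝ :=
  ∫ z : ℝ × ℝ, thetaGapLog z.1 * thetaGapLog z.2 / cosh ((x + z.1 + z.2) / 2)

theorem integrable_thetaGapLog_prod :
    Integrable fun z : ℝ × ℝ ↦ thetaGapLog z.1 * thetaGapLog z.2 :=
  integrable_thetaGapLog.mul_prod integrable_thetaGapLog

theorem integrable_thetaGapPairing (x : ℝ) : Integrable fun z : ℝ × ℝ ↦
    thetaGapLog z.1 * thetaGapLog z.2 / cosh ((x + z.1 + z.2) / 2) := by
  have hm := measurable_thetaGapLog
  refine integrable_thetaGapLog_prod.mono' (Measurable.aestronglyMeasurable (by fun_prop)) (ae_of_all _ fun z ↦ ?_)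
  have h1 := thetaGapLog_nonneg z.1
  have h2 := thetaGapLog_nonneg z.2
  have h3 := cosh_pos ((x + z.1 + z.2) / 2)
  rw [Real.norm_of_nonneg (by positivity)]
  exact div_le_self (by positivity) (one_le_cosh _)

theorem ofReal_thetaGapPairing (x : ℝ) : ENNReal.ofReal (thetaGapPairing x) =
    ∫⁻ r, ∫⁻ s, ENNReal.ofReal (thetaGapLog r * thetaGapLog s / cosh ((x + r + s) / 2)) := by
  have hm := measurable_thetaGapLog
  rw [thetaGapPairing, ofReal_integral_eq_lintegral_ofReal (integrable_thetaGapPairing x)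
    (ae_of_all _ fun z ↦ ?_), Measure.volume_eq_prod, lintegral_prod _ (by fun_prop)]
  have h1 := thetaGapLog_nonneg z.1
  have h2 := thetaGapLog_nonneg z.2
  have h3 := cosh_pos ((x + z.1 + z.2) / 2)
  simp only [Pi.zero_apply]
  positivity

/-- Put `v = exp r`, `w = exp (-s)`: then `v + exp (-x) * w` factors as `2 * exp ((r - s - x) / 2) *
cosh ((x + r + s) / 2)`, and evenness of `thetaGapLog` removes the sign of `s`. -/
theorem lintegral_thetaGap_hilbert (x : ℝ) :
    ∫⁻ v in Ioi (0 : ℝ), ∫⁻ w in Ioi (0 : ℝ), ENNReal.ofReal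
      (exp (-x / 2) * (thetaGap v * thetaGap w / (v + exp (-x) * w))) =
      ENNReal.ofReal (thetaGapPairing x / 2) := by
  have hm := measurable_thetaGapLog
  rw [show thetaGapPairing x / 2 = 2⁻¹ * thetaGapPairing x by ring,
    ENNReal.ofReal_mul (by norm_num), ofReal_thetaGapPairing,
    ← lintegral_const_mul' _ _ ENNReal.ofReal_ne_top, lintegral_Ioi_eq_lintegral_exp]
  refine lintegral_congr fun r ↦ ?_
  rw [← lintegral_const_mul' _ _ ENNReal.ofReal_ne_top, lintegral_Ioi_eq_lintegral_exp,
    ← lintegral_const_mul' _ _ ENNReal.ofReal_ne_top, ← lintegral_neg_eq_self]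
  refine lintegral_congr fun s ↦ ?_
  rw [← ENNReal.ofReal_mul (exp_pos _).le, ← ENNReal.ofReal_mul (exp_pos _).le,
    ← ENNReal.ofReal_mul (by norm_num), ← thetaGapLog_neg s]
  congr 1
  simp only [thetaGapLog, cosh_eq]
  generalize thetaGap (exp r) = A
  generalize thetaGap (exp (-s)) = B
  have e1 : exp ((x + r + s) / 2) = exp (x / 2) * exp (r / 2) * exp (s / 2) := by
    rw [← exp_add, ← exp_add]; ring_nf
  have e2 : exp r = exp (r / 2) * exp (r / 2) := by rw [← exp_add]; ring_nf
  have e3 : exp (-s) = (exp (s / 2) * exp (s / 2))⁻¹ := by rw [← exp_add, ← exp_neg]; ring_nf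
  have e4 : exp (-x) = (exp (x / 2) * exp (x / 2))⁻¹ := by rw [← exp_add, ← exp_neg]; ring_nf
  have e5 : exp (-s / 2) = (exp (s / 2))⁻¹ := by rw [← exp_neg]; ring_nf
  have e6 : exp (-x / 2) = (exp (x / 2))⁻¹ := by rw [← exp_neg]; ring_nf
  rw [exp_neg ((x + r + s) / 2), e1, e2, e3, e4, e5, e6]
  have p1 := exp_pos (r / 2)
  have p2 := exp_pos (s / 2)
  have p3 := exp_pos (x / 2)
  generalize exp (r / 2) = a at *
  generalize exp (s / 2) = b at *
  generalize exp (x / 2) = c at *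
  field_simp

/-- The digamma–Bessel side. -/
theorem lintegral_digamma_bessel (x : ℝ) :
    ∫⁻ t in Ioi (0 : ℝ), ∫⁻ v in Ioi (0 : ℝ), ENNReal.ofReal (binetLaplace t) *
      ENNReal.ofReal (exp (-x / 2) * (2 * thetaGap v * exp (-π * (t * exp (-x)) ^ 2 / v ^ 2) / v)) =
      ENNReal.ofReal (thetaGapPairing x / 2) := by
  have hm := measurable_thetaGap
  have hb := measurable_binetLaplace
  rw [← lintegral_thetaGap_hilbert, lintegral_lintegral_swap (by fun_prop)]
  refine setLIntegral_congr_fun measurableSet_Ioi fun v hv ↦ ?_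
  have hv : 0 < v := hv
  have h0 := thetaGap_nonneg hv
  have hE := exp_pos (-x)
  -- For fixed `v` the `t`-integral is the Gaussian transform with `b = exp (-x) / v`.
  have h1 : ∀ t ∈ Ioi (0 : ℝ), ENNReal.ofReal (binetLaplace t) *
      ENNReal.ofReal (exp (-x / 2) * (2 * thetaGap v * exp (-π * (t * exp (-x)) ^ 2 / v ^ 2) / v)) =
      ENNReal.ofReal (exp (-x / 2) * (2 * thetaGap v / v)) * (ENNReal.ofReal (binetLaplace t) *
        ENNReal.ofReal (exp (-π * ((exp (-x) / v) ^ 2 * t ^ 2)))) := by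
    intro t ht
    rw [mul_left_comm (ENNReal.ofReal (exp (-x / 2) * (2 * thetaGap v / v))),
      ← ENNReal.ofReal_mul (p := exp (-x / 2) * (2 * thetaGap v / v)) (by positivity)]
    congr 2
    rw [show -π * (t * exp (-x)) ^ 2 / v ^ 2 = -π * ((exp (-x) / v) ^ 2 * t ^ 2) by
      field_simp]
    ring
  rw [setLIntegral_congr_fun measurableSet_Ioi h1, lintegral_const_mul' _ _ ENNReal.ofReal_ne_top,
    lintegral_binetLaplace_mul_gaussian (by positivity),
    ← lintegral_const_mul' _ _ ENNReal.ofReal_ne_top]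
  refine setLIntegral_congr_fun measurableSet_Ioi fun w hw ↦ ?_
  have hw : 0 < w := hw
  rw [← ENNReal.ofReal_mul (by positivity)]
  congr 1
  field_simp

/-- With `u = t * exp (-x)` the Bessel factor is `exp (-x / 2)` times the transform of `thetaGap`.
Both factors are nonnegative, so integrability and the value follow from a single Tonelli
computation. -/
theorem digammaBesselIntegrand_eq {x t : ℝ} (ht : 0 < t) :
    digammaBesselIntegrand x t =
      (((∫⁻ v in Ioi (0 : ℝ), ENNReal.ofReal (binetLaplace t) * ENNReal.ofReal (exp (-x / 2) *
        (2 * thetaGap v * exp (-π * (t * exp (-x)) ^ 2 / v ^ 2) / v))).toReal : ℝ) : ℂ) := by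
  have hu : 0 < t * exp (-x) := by positivity
  have h1 : ∀ v : ℝ, ENNReal.ofReal (exp (-x / 2) *
      (2 * thetaGap v * exp (-π * (t * exp (-x)) ^ 2 / v ^ 2) / v)) =
      ENNReal.ofReal (exp (-x / 2)) * ENNReal.ofReal
        (2 * thetaGap v * exp (-π * (t * exp (-x)) ^ 2 / v ^ 2) / v) :=
    fun v ↦ ENNReal.ofReal_mul (exp_pos _).le
  simp_rw [h1]
  rw [lintegral_const_mul' _ _ ENNReal.ofReal_ne_top, lintegral_const_mul' _ _ ENNReal.ofReal_ne_top,
    lintegral_thetaGap_gaussian hu, ENNReal.toReal_mul, ENNReal.toReal_mul,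
    ENNReal.toReal_ofReal (binetLaplace_nonneg t), ENNReal.toReal_ofReal (exp_pos _).le,
    ENNReal.toReal_ofReal (sub_nonneg.2 (four_mul_tsum_besselK_le hu)), Complex.ofReal_mul,
    digammaBesselIntegrand, digamma_add_one_sub_log ht]
  congr 2
  have h2 : ∀ n : ℕ, 2 * π * ((n : ℝ) + 1) * t * exp (-x) =
      2 * π * ((n : ℝ) + 1) * (t * exp (-x)) := fun n ↦ by ring
  simp_rw [h2]
  have e4 : exp (-x) = (exp (x / 2) * exp (x / 2))⁻¹ := by rw [← exp_add, ← exp_neg]; ring_nf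
  have e6 : exp (-x / 2) = (exp (x / 2))⁻¹ := by rw [← exp_neg]; ring_nf
  have e7 : exp (x / 2) / t = exp (-x / 2) * (1 / (t * exp (-x))) := by
    rw [e4, e6]
    have := exp_pos (x / 2)
    field_simp
  rw [e7]
  ring

theorem integral_digammaBesselIntegrand (x : ℝ) :
    IntegrableOn (digammaBesselIntegrand x) (Ioi 0) ∧
      ∫ t in Ioi (0 : ℝ), digammaBesselIntegrand x t = ((thetaGapPairing x / 2 : ℝ) : ℂ) := by
  have hm := measurable_thetaGap
  have hb := measurable_binetLaplace
  set G : ℝ → ENNReal := fun t ↦ ∫⁻ v in Ioi (0 : ℝ), ENNReal.ofReal (binetLaplace t) *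
    ENNReal.ofReal (exp (-x / 2) *
      (2 * thetaGap v * exp (-π * (t * exp (-x)) ^ 2 / v ^ 2) / v)) with hG
  have hGm : Measurable G := by
    have : Measurable (Function.uncurry fun t v : ℝ ↦ ENNReal.ofReal (binetLaplace t) *
      ENNReal.ofReal (exp (-x / 2) *
      (2 * thetaGap v * exp (-π * (t * exp (-x)) ^ 2 / v ^ 2) / v))) := by fun_prop
    exact this.lintegral_prod_right'
  have hGi : ∫⁻ t in Ioi (0 : ℝ), G t = ENNReal.ofReal (thetaGapPairing x / 2) :=
    lintegral_digamma_bessel x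
  have hne : ∫⁻ t in Ioi (0 : ℝ), G t ≠ ⊤ := by rw [hGi]; exact ENNReal.ofReal_ne_top
  have hcongr : EqOn (fun t ↦ (((G t).toReal : ℝ) : ℂ)) (digammaBesselIntegrand x) (Ioi 0) :=
    fun t ht ↦ (digammaBesselIntegrand_eq ht).symm
  have hP : 0 ≤ thetaGapPairing x := by
    refine integral_nonneg fun z ↦ ?_
    have h1 := thetaGapLog_nonneg z.1
    have h2 := thetaGapLog_nonneg z.2
    have h3 := cosh_pos ((x + z.1 + z.2) / 2)
    simp only [Pi.zero_apply]
    positivity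
  constructor
  · have h := (integrable_toReal_of_lintegral_ne_top hGm.aemeasurable hne).ofReal (𝕜 := ℂ)
    exact IntegrableOn.congr_fun h hcongr measurableSet_Ioi
  · rw [← setIntegral_congr_fun measurableSet_Ioi hcongr, integral_complex_ofReal,
      integral_toReal hGm.aemeasurable (ae_lt_top hGm hne), hGi,
      ENNReal.toReal_ofReal (by positivity)]

/-! ### The xi side and the conclusion. -/

theorem completedRiemannZeta_critical_line_sq (t : ℝ) :
    completedRiemannZeta (1 / 2 + Complex.I * t) ^ 2 =
      ∫ z : ℝ × ℝ, Complex.exp (Complex.I * t * (z.1 + z.2)) *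
        ((thetaGapLog z.1 * thetaGapLog z.2 : ℝ) : ℂ) := by
  rw [completedRiemannZeta_critical_line, neg_sq, sq, Measure.volume_eq_prod, ← integral_prod_mul]
  refine integral_congr_ae (ae_of_all _ fun z ↦ ?_)
  simp only
  rw [mul_add, Complex.exp_add]
  push_cast
  ring

/-- The Fourier transform of `Λ(1/2 + it)² / cosh (πt)`. -/
theorem integral_completedRiemannZeta_sq (x : ℝ) :
    Integrable (fun t : ℝ ↦ completedRiemannZeta (1 / 2 + Complex.I * t) ^ 2 *
      (Complex.exp (Complex.I * x * t) * ((1 / cosh (π * t) : ℝ) : ℂ))) ∧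
    ∫ t : ℝ, completedRiemannZeta (1 / 2 + Complex.I * t) ^ 2 *
      (Complex.exp (Complex.I * x * t) * ((1 / cosh (π * t) : ℝ) : ℂ)) =
      (thetaGapPairing x : ℂ) := by
  set f : ℝ × (ℝ × ℝ) → ℂ := fun q ↦
    Complex.exp (Complex.I * ((x + q.2.1 + q.2.2 : ℝ) : ℂ) * q.1) *
      (((1 / cosh (π * q.1)) * (thetaGapLog q.2.1 * thetaGapLog q.2.2) : ℝ) : ℂ) with hf
  have hint : Integrable f (volume.prod volume) := by
    refine Integrable.bdd_mul (c := 1)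
      (integrable_one_div_cosh.mul_prod integrable_thetaGapLog_prod).ofReal
      (Continuous.aestronglyMeasurable (by fun_prop)) (ae_of_all _ fun q ↦ ?_)
    rw [show Complex.I * ((x + q.2.1 + q.2.2 : ℝ) : ℂ) * q.1 =
      (((x + q.2.1 + q.2.2) * q.1 : ℝ) : ℂ) * Complex.I by push_cast; ring,
      Complex.norm_exp_ofReal_mul_I]
  have hrow : ∀ t : ℝ, completedRiemannZeta (1 / 2 + Complex.I * t) ^ 2 *
      (Complex.exp (Complex.I * x * t) * ((1 / cosh (π * t) : ℝ) : ℂ)) = ∫ z : ℝ × ℝ, f (t, z) := by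
    intro t
    rw [completedRiemannZeta_critical_line_sq, ← integral_mul_const]
    refine integral_congr_ae (ae_of_all _ fun z ↦ ?_)
    simp only [hf]
    rw [show Complex.I * ((x + z.1 + z.2 : ℝ) : ℂ) * t =
      Complex.I * t * (z.1 + z.2) + Complex.I * x * t by push_cast; ring, Complex.exp_add]
    push_cast
    ring
  simp_rw [hrow]
  refine ⟨hint.integral_prod_left, ?_⟩
  -- After the swap, the `t`-integral is the sech transform at frequency `x + z.1 + z.2`.
  rw [integral_integral_swap (f := fun t z ↦ f (t, z)) hint, thetaGapPairing,
    ← integral_complex_ofReal]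
  refine integral_congr_ae (ae_of_all _ fun z ↦ ?_)
  have h := integral_cexp_div_cosh (x + z.1 + z.2)
  have h2 : ∀ t : ℝ, f (t, z) = Complex.exp (Complex.I * ((x + z.1 + z.2 : ℝ) : ℂ) * t) *
      ((1 / cosh (π * t) : ℝ) : ℂ) * ((thetaGapLog z.1 * thetaGapLog z.2 : ℝ) : ℂ) := by
    intro t
    simp only [hf]
    push_cast
    ring
  simp_rw [h2]
  rw [integral_mul_const, h, ← Complex.ofReal_mul]
  congr 1
  ring

theorem completedRiemannZeta_critical_line_neg (t : ℝ) :
    completedRiemannZeta (1 / 2 + Complex.I * ((-t : ℝ) : ℂ)) =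
      completedRiemannZeta (1 / 2 + Complex.I * t) := by
  rw [← completedRiemannZeta_one_sub]
  congr 1
  push_cast
  ring

theorem xiSquaredIntegrand_neg (x t : ℝ) : xiSquaredIntegrand x (-t) = xiSquaredIntegrand x t := by
  simp only [xiSquaredIntegrand, riemannXiUpper_sq_div, completedRiemannZeta_critical_line_neg,
    mul_neg, Real.cos_neg, Real.cosh_neg]

/-- Averaging the Fourier integrand over `±t` turns the exponential into the cosine; `1 / 8`
combines this average with the `1 / 4` left from `Ξ²`. -/
theorem xiSquaredIntegrand_eq (x t : ℝ) : xiSquaredIntegrand x t =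
    (1 / 8) * (completedRiemannZeta (1 / 2 + Complex.I * t) ^ 2 *
        (Complex.exp (Complex.I * x * t) * ((1 / cosh (π * t) : ℝ) : ℂ)) +
      completedRiemannZeta (1 / 2 + Complex.I * ((-t : ℝ) : ℂ)) ^ 2 *
        (Complex.exp (Complex.I * x * ((-t : ℝ) : ℂ)) * ((1 / cosh (π * (-t)) : ℝ) : ℂ))) := by
  rw [xiSquaredIntegrand, riemannXiUpper_sq_div, completedRiemannZeta_critical_line_neg, mul_neg,
    Real.cosh_neg]
  have h : ((cos (x * t) : ℝ) : ℂ) = (Complex.exp (Complex.I * x * t) +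
      Complex.exp (Complex.I * x * ((-t : ℝ) : ℂ))) / 2 := by
    rw [Complex.ofReal_cos, Complex.cos]
    congr 3 <;> (push_cast; ring)
  rw [Complex.ofReal_div, h]
  push_cast
  ring

theorem integral_xiSquaredIntegrand (x : ℝ) :
    Integrable (xiSquaredIntegrand x) ∧
      ∫ t, xiSquaredIntegrand x t = ((thetaGapPairing x / 4 : ℝ) : ℂ) := by
  obtain ⟨hi, hv⟩ := integral_completedRiemannZeta_sq x
  rw [funext (xiSquaredIntegrand_eq x)]
  refine ⟨(hi.add hi.comp_neg).const_mul _, ?_⟩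
  rw [integral_const_mul, integral_add hi hi.comp_neg, integral_neg_eq_self
    (fun t : ℝ ↦ completedRiemannZeta (1 / 2 + Complex.I * t) ^ 2 *
      (Complex.exp (Complex.I * x * t) * ((1 / cosh (π * t) : ℝ) : ℂ))), hv]
  push_cast
  ring

theorem integral_Ioi_xiSquaredIntegrand (x : ℝ) :
    ∫ t in Ioi (0 : ℝ), xiSquaredIntegrand x t = ((thetaGapPairing x / 8 : ℝ) : ℂ) := by
  obtain ⟨hi, hv⟩ := integral_xiSquaredIntegrand x
  have h := intervalIntegral.integral_Iic_add_Ioi (b := (0 : ℝ)) hi.integrableOn hi.integrableOn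
  have h2 := integral_comp_neg_Iic 0 (xiSquaredIntegrand x)
  simp only [xiSquaredIntegrand_neg, neg_zero] at h2
  rw [h2, hv, ← two_mul] at h
  refine mul_left_cancel₀ two_ne_zero (h.trans ?_)
  push_cast
  ring

theorem theorem2 (x : ℝ) (hx : 0 < x) :
    (∀ t : ℝ, 0 < t →
      Summable fun n : ℕ => besselK 0 (2 * Real.pi * ((n : ℝ) + 1) * t * Real.exp (-x))) ∧
    MeasureTheory.IntegrableOn (digammaBesselIntegrand x) (Set.Ioi (0 : ℝ)) ∧
    MeasureTheory.IntegrableOn (xiSquaredIntegrand x) (Set.Ioi (0 : ℝ)) ∧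
    (∫ t in Set.Ioi (0 : ℝ), digammaBesselIntegrand x t) =
      4 * ∫ t in Set.Ioi (0 : ℝ), xiSquaredIntegrand x t := by
  obtain ⟨hd, hdv⟩ := integral_digammaBesselIntegrand x
  refine ⟨fun t ht ↦ ?_, hd, (integral_xiSquaredIntegrand x).1.integrableOn, ?_⟩
  · refine (summable_besselK (u := t * exp (-x)) (by positivity)).congr fun n ↦ ?_
    rw [← mul_assoc]
  · rw [hdv, integral_Ioi_xiSquaredIntegrand]
    push_cast
    ring
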